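/- Let $\Sigma$ be a finite family of nondegenerate simplices of $\mathbb{R}^d$, let $d_\sigma$ be the dimension of $\sigma\in\Sigma$ and $K=\bigcup_{\sigma\in\Sigma}\sigma$. Let $\mu$ be the probability measure $\mu(B)=\sum_{\sigma\in\Sigma}\int_{B\cap\sigma}\rho_\sigma\,d\mathcal{H}^{d_\sigma}$, and assume that it is regular: $d_\sigma\ge 2$ for all $\sigma$; every $\rho_\sigma:\sigma\to\mathbb{R}$ is continuous with $\min_\sigma\rho_\sigma>0$; and $K\setminus S$ is connected for every finite $S\subseteq K$. Let $y_1,\dots,y_N\in\mathbb{R}^d$ be in generic position with respect to every simplex $\sigma=[x_0,\dots,x_k]\in\Sigma$, i.e. for all integers $1\le p\le k$ and $1\le \ell\le\min(d,N-1)$, all distinct $i_0,\dots,i_\ell\in\{1,\dots,N\}$ and all distinct $j_0,\dots,j_p\in\{0,\dots,k\}$, $$\dim\bigl(\{y_{i_1}-y_{i_0},\dots,y_{i_\ell}-y_{i_0}\}^\perp\cap\mathrm{vect}(x_{j_1}-x_{j_0},\dots,x_{j_p}-x_{j_0})\bigr)=\max(p-\ell,0).$$ For $\psi\in\mathbb{R}^N$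 put $\mathrm{Lag}_i(\psi)=\{x\in K: \|x-y_i\|^2+\psi_i\le\|x-y_j\|^2+\psi_j\ \forall j\}$, $G_i(\psi)=\mu(\mathrm{Lag}_i(\psi))$ and $G=(G_1,\dots,G_N)$. Let $\nu\in\mathbb{R}^N$ with $\nu_i\ge 0$ and $\sum_i\nu_i=1$. All norms are Euclidean. Given $\psi^0\in\mathbb{R}^N$ such that $\varepsilon_0:=\tfrac12\min\bigl(\min_iG_i(\psi^0),\min_i\nu_i\bigr)>0$ and a tolerance $\eta>0$, the damped Newton algorithm does the following while $\|G(\psi^k)-\nu\|\ge\eta$: it computes $v^k=-DG(\psi^k)^+(G(\psi^k)-\nu)$, where $A^+$ is the Moore–Penrose pseudo-inverse of $A$; it determines the least $\ell\in\mathbb{N}$ such that $\psi^{k,\ell}=\psi^k+2^{-\ell}v^k$ satisfies $$\min_iG_i(\psi^{k,\ell})\ge\varepsilon_0\quad\text{and}\quad\|G(\psi^{k,\ell})-\nu\|\le(1-2^{-(\ell+1)})\|G(\psi^k)-\nu\|;$$ and it sets $\psi^{k+1}=\psi^{k,\ell}$ for this $\ell$. Then every step of the algorithm is well defined ($G$ is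 differentiable at the iterates and the required $\ell$ exists), and the algorithm stops after finitely many steps, at an iterate with $\|G(\psi^k)-\nu\|<\eta$. Moreover there is $\tau^*\in(0,1]$, depending only on $\mu$, $\nu$ (including the points $y_i$) and $\varepsilon_0$, and not on $\psi^0$ or $\eta$ otherwise, such that all iterates satisfy $$\|G(\psi^{k+1})-\nu\|\le\Bigl(1-\frac{\tau^*}{2}\Bigr)\|G(\psi^k)-\nu\|.$$ -/

import Mathlib

open MeasureTheory Set
open scoped ENNReal

noncomputable section

namespace SemiDiscrete

/-- A simplex soup in `ℝ^d`: a finite family (the index type is finite wherever this is used) of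
nondegenerate simplices, possibly of different dimensions. -/
structure SimplexSoup (d : ℕ) (ι : Type*) where
  /-- the dimension `d_σ` of each simplex -/
  dim : ι → ℕ
  /-- the simplices, given by their affinely independent vertices -/
  simplex : (s : ι) → Affine.Simplex ℝ (EuclideanSpace ℝ (Fin d)) (dim s)

namespace SimplexSoup

variable {d : ℕ} {ι : Type*} (S : SimplexSoup d ι)

/-- The simplex `σ = [x₀, …, x_k]` as a closed convex subset of `ℝ^d`. -/
def cell (s : ι) : Set (EuclideanSpace ℝ (Fin d)) :=
  convexHull ℝ (Set.range (S.simplex s).points)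

/-- The support `K` of the soup: the union of its simplices. -/
def support : Set (EuclideanSpace ℝ (Fin d)) := ⋃ s, S.cell s

end SimplexSoup

/-- The data of a simplicial measure: a simplex soup and a nonnegative density on each simplex. -/
structure SimplicialMeasure (d : ℕ) (ι : Type*) where
  /-- the underlying soup -/
  soup : SimplexSoup d ι
  /-- the densities `ρ_σ`; only their values on the simplex matter -/
  density : ι → EuclideanSpace ℝ (Fin d) → ℝ
  measurable_density : ∀ s, Measurable ((soup.cell s).domRestrict (density s))
  density_nonneg : ∀ s, ∀ x ∈ soup.cell s, 0 ≤ density s x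

namespace SimplicialMeasure

variable {d : ℕ} {ι : Type*} (M : SimplicialMeasure d ι)

/-- The measure `B ↦ ∑_σ ∫_{B ∩ σ} ρ_σ dℋ^{d_σ}`. Here `μHE[k]` is the `k`-dimensional Hausdorff
measure with the usual normalisation (it agrees with Lebesgue measure on `ℝ^k`). -/
def toMeasure [Fintype ι] : Measure (EuclideanSpace ℝ (Fin d)) :=
  ∑ s, ((μHE[M.soup.dim s]).restrict (M.soup.cell s)).withDensity
    (fun x => ENNReal.ofReal (M.density s x))

/-- Regular simplicial measures. -/
structure IsRegular : Prop where
  two_le_dim : ∀ s, 2 ≤ M.soup.dim s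
  continuousOn_density : ∀ s, ContinuousOn (M.density s) (M.soup.cell s)
  density_pos : ∀ s, ∃ c : ℝ, 0 < c ∧ ∀ x ∈ M.soup.cell s, c ≤ M.density s x
  isConnected_diff : ∀ F : Set (EuclideanSpace ℝ (Fin d)), F ⊆ M.soup.support → F.Finite →
    IsConnected (M.soup.support \ F)

end SimplicialMeasure

/-- The points `y₁, …, y_N` are in generic position with respect to the `k`-simplex with vertices
`x₀, …, x_k`. The subtraction `p - l` is truncated, i.e. it is `max (p - l) 0`. -/
def IsGenericFor {d N k : ℕ} (y : Fin N → EuclideanSpace ℝ (Fin d))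
    (σ : Affine.Simplex ℝ (EuclideanSpace ℝ (Fin d)) k) : Prop :=
  ∀ p l : ℕ, 1 ≤ p → p ≤ k → 1 ≤ l → l ≤ min d (N - 1) →
    ∀ (i : Fin (l + 1) → Fin N) (j : Fin (p + 1) → Fin (k + 1)),
      Function.Injective i → Function.Injective j →
      Module.finrank ℝ
        ↥((Submodule.span ℝ (Set.range fun a : Fin l => y (i a.succ) - y (i 0)))ᗮ ⊓
          Submodule.span ℝ
            (Set.range fun b : Fin p => σ.points (j b.succ) - σ.points (j 0))) = p - l

/-- Generic position with respect to all simplices of a soup. -/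
def IsGeneric {d N : ℕ} {ι : Type*} (y : Fin N → EuclideanSpace ℝ (Fin d))
    (S : SimplexSoup d ι) : Prop :=
  ∀ s, IsGenericFor y (S.simplex s)

/-- The `i`-th power cell of the points `y` with weights `ψ`. -/
def powerCell {d N : ℕ} (y : Fin N → EuclideanSpace ℝ (Fin d)) (ψ : EuclideanSpace ℝ (Fin N))
    (i : Fin N) : Set (EuclideanSpace ℝ (Fin d)) :=
  {x | ∀ j, ‖x - y i‖ ^ 2 + ψ i ≤ ‖x - y j‖ ^ 2 + ψ j}

/-- The `i`-th Laguerre cell: the part of the power cell that lies in the support of the soup. -/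
def laguerreCell {d N : ℕ} {ι : Type*} (S : SimplexSoup d ι)
    (y : Fin N → EuclideanSpace ℝ (Fin d)) (ψ : EuclideanSpace ℝ (Fin N)) (i : Fin N) :
    Set (EuclideanSpace ℝ (Fin d)) :=
  powerCell y ψ i ∩ S.support

/-- The map `G : ℝ^N → ℝ^N`, `G_i(ψ) = μ(Lag_i(ψ))`. -/
def massMap {d N : ℕ} {ι : Type*} [Fintype ι] (M : SimplicialMeasure d ι)
    (y : Fin N → EuclideanSpace ℝ (Fin d)) (ψ : EuclideanSpace ℝ (Fin N)) :
    EuclideanSpace ℝ (Fin N) :=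
  WithLp.toLp 2 fun i => M.toMeasure.real (laguerreCell M.soup y ψ i)

/-- `B` is the (Moore–Penrose) pseudo-inverse `A⁺` of `A`: the four Penrose equations, which
determine `B`. -/
structure IsPseudoInverse {N : ℕ}
    (A B : EuclideanSpace ℝ (Fin N) →L[ℝ] EuclideanSpace ℝ (Fin N)) : Prop where
  mul_mul_left : A * B * A = A
  mul_mul_right : B * A * B = B
  isSelfAdjoint_left : IsSelfAdjoint (A * B)
  isSelfAdjoint_right : IsSelfAdjoint (B * A)

section Algorithm

variable {N : ℕ} (G : EuclideanSpace ℝ (Fin N) → EuclideanSpace ℝ (Fin N))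
  (ν : EuclideanSpace ℝ (Fin N)) (ε₀ : ℝ)

/-- `v` is the Newton direction `-DG(ψ)⁺ (G(ψ) - ν)`; in particular `G` is differentiable
at `ψ`. -/
def IsNewtonDirection (ψ v : EuclideanSpace ℝ (Fin N)) : Prop :=
  ∃ A B : EuclideanSpace ℝ (Fin N) →L[ℝ] EuclideanSpace ℝ (Fin N),
    HasFDerivAt G A ψ ∧ IsPseudoInverse A B ∧ v = -B (G ψ - ν)

/-- The exponents `ℓ` for which the damped step `ψ + 2^{-ℓ} v` is acceptable. -/
def admissibleExponents (ψ v : EuclideanSpace ℝ (Fin N)) : Set ℕ :=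
  {l | (∀ i, ε₀ ≤ G (ψ + (2⁻¹ : ℝ) ^ l • v) i) ∧
    ‖G (ψ + (2⁻¹ : ℝ) ^ l • v) - ν‖ ≤ (1 - (2⁻¹ : ℝ) ^ (l + 1)) * ‖G ψ - ν‖}

/-- One pass through the loop of the damped Newton algorithm: the next iterate is
`ψ' = ψ + 2^{-ℓ} v`, with `v` the Newton direction and `ℓ` the least acceptable exponent. -/
def IsDampedNewtonStep (ψ ψ' : EuclideanSpace ℝ (Fin N)) : Prop :=
  ∃ (v : EuclideanSpace ℝ (Fin N)) (l : ℕ), IsNewtonDirection G ν ψ v ∧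
    IsLeast (admissibleExponents G ν ε₀ ψ v) l ∧ ψ' = ψ + (2⁻¹ : ℝ) ^ l • v

/-- `ψ 0, …, ψ T` are the first iterates of the damped Newton algorithm started at `ψ₀` with
tolerance `η`: the loop is executed at each `ψ k`, `k < T`, the loop condition being satisfied
there. Nothing is said about `ψ k` for `k > T`. -/
def IsDampedNewtonRun (η : ℝ) (ψ₀ : EuclideanSpace ℝ (Fin N)) (T : ℕ)
    (ψ : ℕ → EuclideanSpace ℝ (Fin N)) : Prop :=
  ψ 0 = ψ₀ ∧ ∀ k < T, η ≤ ‖G (ψ k) - ν‖ ∧ IsDampedNewtonStep G ν ε₀ (ψ k) (ψ (k + 1))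

end Algorithm

end SemiDiscrete

end

open SemiDiscrete

/-! The damped Newton method converges globally because the mass map `G` is `C¹` and its derivative
is invertible modulo constants, uniformly over all `ψ` whose cells have mass at least `ε₀`.
`IsMassLike` isolates the properties used, so the proof has an analytic half about `G` and an
abstract half about Newton steps.

Smoothness: in affine coordinates on a simplex, a Laguerre cell is a polyhedron whose offsets depend
affinely on the differences `ψ j - ψ i`. Moving one facet changes the integral at the rate of the
integral over that facet (Fubini and the fundamental theorem of calculus). This rate is continuous
by dominated convergence, provided that no other facet is parallel to the moving one. Generic
position and `d_σ ≥ 2` ensure this, so `G` has continuous partial derivatives.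

Kernel: `DG` is the Laplacian of a graph with nonnegative weights, positive from `i` to `j` when the
two cells meet in the interior of a simplex away from the other cells. If the cells of positive mass
were split into two groups with no such edge, the groups could meet only at finitely many
exceptional points (`exists_interior_tie`), contradicting connectedness of `K` minus a finite set.
By the maximum principle the kernel then consists of constants. The total mass is 1, so the range
has sum zero; no symmetry of `DG` is needed.

Convergence: modulo constants, the set where all masses are at least `ε₀` is compact. On it the
inverse derivative is bounded and the linearization error is uniform, so every sufficiently small
dyadic step is accepted, with one threshold for all iterates (`exists_stepSize`). The residual
therefore decreases geometrically. -/

namespace SemiDiscrete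

open Filter Topology Asymptotics

/-! ### Calculus: partial derivatives, null hyperplanes, slices of polyhedra -/

/-- A function on `ι → ℝ` with continuous partial derivatives is differentiable. -/
theorem hasFDerivAt_of_continuous_partials {ι : Type*} [Fintype ι] [DecidableEq ι]
    {F : (ι → ℝ) → ℝ} {g : ι → (ι → ℝ) → ℝ} (hg : ∀ i, Continuous (g i))
    (hF : ∀ i c, HasDerivAt (fun t => F (Function.update c i t)) (g i c) (c i)) (c : ι → ℝ) :
    HasFDerivAt F (∑ i, g i c • (ContinuousLinearMap.proj i : (ι → ℝ) →L[ℝ] ℝ)) c := by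
  -- Move the coordinates one at a time: `s` is the set of coordinates already moved from `c` to `c
  -- + h`.
  have key : ∀ s : Finset ι,
      (fun h : ι → ℝ => F (c + s.piecewise h 0) - F c - ∑ i ∈ s, g i c * h i)
        =o[𝓝 0] (fun h : ι → ℝ => h) := by
    intro s
    induction s using Finset.induction_on with
    | empty => simp
    | insert a s ha ih =>
      have hp : Continuous fun h : ι → ℝ => c + s.piecewise h 0 := by
        refine continuous_const.add (continuous_pi fun i => ?_)
        by_cases hi : i ∈ s <;> simp [hi] <;> fun_prop
      have hgc : Continuous fun p : (ι → ℝ) × ℝ =>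
          g a (Function.update (c + s.piecewise p.1 0) a p.2) :=
        (hg a).comp ((hp.comp continuous_fst).update a continuous_snd)
      have e2 : ∀ h : ι → ℝ, Function.update (c + s.piecewise h 0) a (c a)
          = c + s.piecewise h 0 := fun h => by
        rw [Function.update_eq_self_iff]; simp [ha]
      have h2 : (fun h : ι → ℝ => F (c + (insert a s).piecewise h 0) - F (c + s.piecewise h 0)
          - g a c * h a) =o[𝓝 0] (fun h : ι → ℝ => h) := by
        rw [isLittleO_iff]
        intro ε hε
        have hev := (Metric.continuousAt_iff.1 (hgc.continuousAt (x := (0, c a)))) ε hε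
        obtain ⟨δ, hδ, hball⟩ := hev
        filter_upwards [Metric.ball_mem_nhds (0 : ι → ℝ) hδ] with h hh
        have hh' : ‖h‖ < δ := by simpa using hh
        have hha : |h a| ≤ ‖h‖ := norm_le_pi_norm h a
        have e1 : Function.update (c + s.piecewise h 0) a (c a + h a)
            = c + (insert a s).piecewise h 0 := by
          rw [Finset.piecewise_insert]
          ext i
          by_cases hi : i = a
          · subst hi; simp
          · simp [hi]
        -- Mean value inequality in coordinate `a`, after subtracting the linear function of slope
        -- `g a c`; continuity of `g a` at `c` makes the remaining slope at most `ε`.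
        have hmv := (convex_uIcc (c a) (c a + h a)).norm_image_sub_le_of_norm_hasDerivWithin_le
          (f := fun t => F (Function.update (c + s.piecewise h 0) a t) - g a c * t)
          (f' := fun t => g a (Function.update (c + s.piecewise h 0) a t) - g a c) (C := ε)
          (x := c a) (y := c a + h a)
          (fun t _ => by
            have := hF a (Function.update (c + s.piecewise h 0) a t)
            simp only [Function.update_idem, Function.update_self] at this
            simpa [Pi.sub_def] using (this.sub ((hasDerivAt_id t).const_mul (g a c))).hasDerivWithinAt)
          (fun t ht => by
            have ht' : |t - c a| ≤ |h a| := by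
              simpa using abs_sub_left_of_mem_uIcc ht
            have := hball (x := (h, t)) (by
              rw [Prod.dist_eq, max_lt_iff]
              exact ⟨by simpa using hh', by rw [Real.dist_eq]; linarith⟩)
            rw [Real.dist_eq] at this
            simp only [Finset.piecewise_same, add_zero, Function.update_eq_self] at this
            exact this.le)
          left_mem_uIcc right_mem_uIcc
        simp only [e1, e2] at hmv
        have e3 : F (c + (insert a s).piecewise h 0) - F (c + s.piecewise h 0) - g a c * h a
            = F (c + (insert a s).piecewise h 0) - g a c * (c a + h a)
              - (F (c + s.piecewise h 0) - g a c * c a) := by ring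
        rw [e3]
        refine hmv.trans ?_
        have : ‖c a + h a - c a‖ ≤ ‖h‖ := by simpa using hha
        gcongr
      refine (h2.add ih).congr_left fun h => ?_
      rw [Finset.sum_insert ha]; ring
  rw [hasFDerivAt_iff_isLittleO_nhds_zero]
  refine (key Finset.univ).congr_left fun h => ?_
  simp

/-- The hyperplanes of a nonzero functional are Haar null. -/
theorem measure_hyperplane {E : Type*} [NormedAddCommGroup E] [NormedSpace ℝ E]
    [FiniteDimensional ℝ E] [MeasurableSpace E] [BorelSpace E] (μ : Measure E) [μ.IsAddHaarMeasure] {l : E →L[ℝ] ℝ} (hl : l ≠ 0)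
    (a : ℝ) : μ {x | l x = a} = 0 := by
  obtain ⟨e, he⟩ : ∃ e, l e ≠ 0 := by
    by_contra! h
    exact hl (ContinuousLinearMap.ext h)
  have h0 : {x | l x = a} = (fun x => x + (-(a / l e) • e)) ⁻¹' (l.toLinearMap.ker : Set E) := by
    ext x
    simp [he, add_neg_eq_zero]
  rw [h0, measure_preimage_add_right]
  refine Measure.addHaar_submodule _ _ fun htop => he ?_
  have : e ∈ l.toLinearMap.ker := htop ▸ Submodule.mem_top
  simpa using this

/-- The integrals of `f` over the slices `{x ∈ polyhedron | x ∈ s e + W}` depend continuously on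
the position of the slice and on the polyhedron. -/
theorem continuous_sliceIntegral {E : Type*} [NormedAddCommGroup E] [NormedSpace ℝ E]
    {κ : Type*} [Finite κ] {W : Type*} [NormedAddCommGroup W] [NormedSpace ℝ W]
    [FiniteDimensional ℝ W] [MeasurableSpace W] [BorelSpace W] (ν : Measure W) [ν.IsAddHaarMeasure]
    (T : (ℝ × W) ≃L[ℝ] E) {f : E → ℝ} (hf : Continuous f) (hfc : HasCompactSupport f)
    (l : κ → E →L[ℝ] ℝ) (p : κ → Prop) (hl : ∀ m, p m → ∃ w, l m (T (0, w)) ≠ 0) :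
    Continuous fun q : (κ → ℝ) × ℝ =>
      ∫ w in {w | ∀ m, p m → l m (T (q.2, w)) ≤ q.1 m}, f (T (q.2, w)) ∂ν := by
  have hmeas : ∀ q : (κ → ℝ) × ℝ, MeasurableSet {w | ∀ m, p m → l m (T (q.2, w)) ≤ q.1 m} :=
    fun q => by
      simp only [ofPred_forall]
      exact (isClosed_iInter fun m => isClosed_iInter fun _ =>
        isClosed_le (by fun_prop) continuous_const).measurableSet
  simp_rw [← integral_indicator (hmeas _)]
  obtain ⟨C, hC⟩ := hf.bounded_above_of_compact_support hfc
  set Q : Set W := (fun x => (T.symm x).2) '' tsupport f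
  -- `Q` contains the support of every slice of `f`, whatever its position, so `C` on `Q` is a
  -- dominating function.
  have hQc : IsCompact Q := hfc.isCompact.image (by fun_prop)
  rw [continuous_iff_continuousAt]
  intro q₀
  refine continuousAt_of_dominated (bound := Q.indicator fun _ => C) ?_ ?_ ?_ ?_
  · exact Eventually.of_forall fun q =>
      ((by fun_prop : Continuous fun w => f (T (q.2, w))).aestronglyMeasurable).indicator (hmeas q)
  · refine Eventually.of_forall fun q => Eventually.of_forall fun w => ?_
    refine (norm_indicator_le_norm_self _ _).trans ?_
    by_cases hw : w ∈ Q
    · simpa [hw] using hC _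
    · have : f (T (q.2, w)) = 0 := by
        by_contra h
        exact hw ⟨T (q.2, w), subset_tsupport _ h, by simp⟩
      simp [this, hw]
  · exact (integrable_indicator_iff hQc.measurableSet).2
      (integrableOn_const (hQc.measure_lt_top.ne))
  · have hnull : ∀ᵐ w ∂ν, ∀ m, p m → l m (T (q₀.2, w)) ≠ q₀.1 m := by
      rw [ae_all_iff]
      intro m
      by_cases hm : p m
      · have h0 : ((l m).comp (T : (ℝ × W) →L[ℝ] E)).comp (ContinuousLinearMap.inr ℝ ℝ W) ≠ 0 := by
          obtain ⟨w, hw⟩ := hl m hm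
          exact fun h => hw (by simpa using congrArg (fun A => A w) h)
        have := measure_hyperplane ν h0 (q₀.1 m - l m (T (q₀.2, 0)))
        filter_upwards [compl_mem_ae_iff.2 this] with w hw _ h
        apply hw
        have hs : T (q₀.2, w) = T (q₀.2, 0) + T (0, w) := by simp [← map_add]
        rw [hs, map_add] at h
        simp only [mem_ofPred_eq]
        simp
        linarith
      · exact Eventually.of_forall fun w h => absurd h hm
    filter_upwards [hnull] with w hw
    have hcont : ∀ m, Continuous fun q : (κ → ℝ) × ℝ => l m (T (q.2, w)) := fun m => by fun_prop
    have hcont' : ∀ m, Continuous fun q : (κ → ℝ) × ℝ => q.1 m := fun m => by fun_prop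
    by_cases hin : ∀ m, p m → l m (T (q₀.2, w)) ≤ q₀.1 m
    · have hev : ∀ᶠ q in 𝓝 q₀, ∀ m, p m → l m (T (q.2, w)) ≤ q.1 m := by
        rw [eventually_all]
        intro m
        by_cases hm : p m
        · filter_upwards [(hcont m).continuousAt.eventually_lt (hcont' m).continuousAt
            (lt_of_le_of_ne (hin m hm) (hw m hm))] with q hq _ using hq.le
        · exact Eventually.of_forall fun q h => absurd h hm
      refine ContinuousAt.congr (f := fun q : (κ → ℝ) × ℝ => f (T (q.2, w))) (by fun_prop) ?_
      filter_upwards [hev] with q hq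
      rw [indicator_of_mem]
      exact hq
    · push Not at hin
      obtain ⟨m, hm, hlt⟩ := hin
      refine ContinuousAt.congr (f := fun _ => (0 : ℝ)) continuousAt_const ?_
      filter_upwards [(hcont' m).continuousAt.eventually_lt (hcont m).continuousAt hlt] with q hq
      rw [indicator_of_notMem]
      exact fun h => absurd (h m hm) (not_le.2 hq)

/-! ### Differentiating the integral over a polyhedron in one offset -/

section CutIntegral

variable {E : Type*} [NormedAddCommGroup E] [NormedSpace ℝ E] [FiniteDimensional ℝ E]
  [MeasurableSpace E] [BorelSpace E]

variable {κ : Type*}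

/-- The integral of `f` over the polyhedron `{x | ∀ m, ℓ m x ≤ c m}`. -/
noncomputable def cutIntegral (μ : Measure E) (f : E → ℝ) (l : κ → E →L[ℝ] ℝ) (c : κ → ℝ) : ℝ :=
  ∫ x in {x | ∀ m, l m x ≤ c m}, f x ∂μ

variable [Finite κ]

/-- The integral of a continuous function over a polyhedron has continuous partial derivatives
with respect to the offset of a facet that is parallel to no other facet. -/
theorem exists_hasDerivAt_cutIntegral [DecidableEq κ] (μ : Measure E) [μ.IsAddHaarMeasure]
    {f : E → ℝ} (hf : Continuous f) (hfc : HasCompactSupport f) (hf0 : ∀ x, 0 ≤ f x)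
    (l : κ → E →L[ℝ] ℝ) (j : κ) (hj : l j ≠ 0)
    (hl : ∀ m, m ≠ j → ∃ w, l j w = 0 ∧ l m w ≠ 0) :
    ∃ g : (κ → ℝ) → ℝ, Continuous g ∧ (∀ c, 0 ≤ g c) ∧
      (∀ c, HasDerivAt (fun t => cutIntegral μ f l (Function.update c j t)) (g c) (c j)) ∧
      ∀ c x, l j x = c j → (∀ m, m ≠ j → l m x < c m) → 0 < f x → 0 < g c := by
  obtain ⟨e, he⟩ : ∃ e, l j e = 1 := by
    obtain ⟨e, he⟩ : ∃ e, l j e ≠ 0 := by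
      by_contra! h
      exact hj (ContinuousLinearMap.ext h)
    exact ⟨(l j e)⁻¹ • e, by simp [he]⟩
  have hinv : Function.RightInverse (ContinuousLinearMap.toSpanSingleton ℝ e) (l j) :=
    fun s => by simp [he]
  -- Coordinates in which `l j` is the first component, so that moving facet `j` moves only the
  -- endpoint of a one-dimensional integral.
  set T : (ℝ × (l j).ker) ≃L[ℝ] E :=
    (ContinuousLinearEquiv.equivOfRightInverse (l j) _ hinv).symm
  have hTa : ∀ s w, T (s, w) = s • e + (w : E) := fun s w => rfl
  have hTj : ∀ s w, l j (T (s, w)) = s := fun s w => by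
    have : l j (w : E) = 0 := w.2
    simp [hTa, he, this]
  set ν : Measure (l j).ker := Measure.addHaar
  have : (Measure.map T.symm μ).IsAddHaarMeasure := T.symm.isAddHaarMeasure_map μ
  -- Haar measures agree up to a scalar; only the positivity of this Jacobian factor is needed.
  set C₀ : NNReal :=
    (Measure.map T.symm μ).addHaarScalarFactor ((volume : Measure ℝ).prod ν)
  set C : ℝ := (C₀ : ℝ)
  have hCpos : 0 < C := by
    have := Measure.addHaarScalarFactor_pos_of_isAddHaarMeasure (Measure.map T.symm μ)
      ((volume : Measure ℝ).prod ν)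
    exact_mod_cast this
  have hμ : ∀ F : E → ℝ, ∫ x, F x ∂μ = C * ∫ q, F (T q) ∂((volume : Measure ℝ).prod ν) := by
    intro F
    have h1 : ∫ x, F x ∂μ = ∫ q, F (T q) ∂(Measure.map T.symm μ) := by
      have hme : MeasurableEmbedding T.symm := T.symm.toHomeomorph.measurableEmbedding
      rw [hme.integral_map]
      simp
    rw [h1, Measure.isAddLeftInvariant_eq_smul (Measure.map T.symm μ)
      ((volume : Measure ℝ).prod ν), integral_smul_nnreal_measure]
    rfl
  set S : (κ → ℝ) × ℝ → Set (l j).ker := fun q => {w | ∀ m, m ≠ j → l m (T (q.2, w)) ≤ q.1 m}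
    with hS
  set φ : (κ → ℝ) × ℝ → ℝ := fun q => ∫ w in S q, f (T (q.2, w)) ∂ν with hφ
  have hφc : Continuous φ := continuous_sliceIntegral ν T hf hfc l (fun m => m ≠ j) fun m hm => by
    obtain ⟨w, hw, hw'⟩ := hl m hm
    exact ⟨⟨w, hw⟩, by simpa [hTa] using hw'⟩
  have hSm : ∀ q, MeasurableSet (S q) := fun q => by
    simp only [hS, ofPred_forall]
    exact (isClosed_iInter fun m => isClosed_iInter fun _ =>
      isClosed_le (by fun_prop) continuous_const).measurableSet
  have hPm : ∀ c : κ → ℝ, MeasurableSet {x | ∀ m, l m x ≤ c m} := fun c => by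
    simp only [ofPred_forall]
    exact (isClosed_iInter fun m => isClosed_le (by fun_prop) continuous_const).measurableSet
  have hφint : ∀ c, Integrable fun s => φ (c, s) := by
    intro c
    refine Continuous.integrable_of_hasCompactSupport (by fun_prop) ?_
    refine HasCompactSupport.of_support_subset_isCompact
      (hfc.isCompact.image (f := fun x => l j x) (by fun_prop)) fun s hs => ?_
    by_contra hns
    apply hs
    have : ∀ w, f (T (s, w)) = 0 := fun w => by
      by_contra h
      exact hns ⟨T (s, w), subset_tsupport _ h, hTj s w⟩
    simp [hφ, this]
  have hcut : ∀ c, cutIntegral μ f l c = C * ∫ s in Iic (c j), φ (c, s) := by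
    intro c
    rw [cutIntegral, ← integral_indicator (hPm c), hμ, integral_prod, ← integral_indicator
      measurableSet_Iic]
    · congr 2
      ext s
      by_cases hs : s ≤ c j
      · rw [indicator_of_mem (by exact hs), hφ]
        simp only
        rw [← integral_indicator (hSm _)]
        congr 1
        ext w
        simp only [indicator, hS, mem_ofPred_eq]
        congr 1
        refine propext ⟨fun h m _ => h m, fun h m => ?_⟩
        by_cases hm : m = j
        · subst hm; rw [hTj]; exact hs
        · exact h m hm
      · rw [indicator_of_notMem (by exact hs)]
        refine integral_eq_zero_of_ae (Eventually.of_forall fun w => ?_)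
        exact indicator_of_notMem (fun h => hs (by simpa [hTj] using h j)) f
    · have hi : Integrable (fun q => f (T q)) ((volume : Measure ℝ).prod ν) :=
        (hf.comp T.continuous).integrable_of_hasCompactSupport
          (hfc.comp_homeomorph T.toHomeomorph)
      exact hi.indicator ((hPm c).preimage T.continuous.measurable)
  -- The slice integral ignores the offset of facet `j`, so that offset enters only through the
  -- upper limit of integration.
  have hφupd : ∀ c t s, φ (Function.update c j t, s) = φ (c, s) := by
    intro c t s
    have : S (Function.update c j t, s) = S (c, s) := by
      ext w
      simp only [hS, mem_ofPred_eq]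
      refine forall_congr' fun m => forall_congr' fun hm => ?_
      rw [Function.update_of_ne hm]
    simp only [hφ, this]
  refine ⟨fun c => C * φ (c, c j), by fun_prop, fun c => ?_, fun c => ?_, ?_⟩
  · exact mul_nonneg hCpos.le (integral_nonneg fun w => hf0 _)
  · simp only [hcut, Function.update_self, hφupd]
    refine HasDerivAt.const_mul _ ?_
    have h1 : ∀ t, ∫ s in Iic t, φ (c, s)
        = (∫ s in Iic (c j), φ (c, s)) + ∫ s in (c j)..t, φ (c, s) := fun t => by
      rw [← intervalIntegral.integral_Iic_sub_Iic (hφint c).integrableOn (hφint c).integrableOn]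
      ring
    rw [funext h1]
    refine HasDerivAt.const_add _ ?_
    have hc : Continuous fun s => φ (c, s) := by fun_prop
    exact intervalIntegral.integral_hasDerivAt_right (hc.intervalIntegrable _ _)
      (hc.stronglyMeasurableAtFilter _ _) hc.continuousAt
  · intro c x hxj hxm hfx
    refine mul_pos hCpos ?_
    obtain ⟨⟨s, w⟩, rfl⟩ := T.surjective x
    rw [hTj] at hxj
    subst hxj
    simp only [hφ]
    have hint : Integrable (fun w => f (T (c j, w))) ν := by
      refine Continuous.integrable_of_hasCompactSupport (hf.comp (T.continuous.comp
        (continuous_const.prodMk continuous_id))) ?_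
      refine HasCompactSupport.of_support_subset_isCompact
        (hfc.isCompact.image (continuous_snd.comp T.symm.continuous)) fun w hw => ?_
      exact ⟨T (c j, w), subset_tsupport _ hw, by simp⟩
    rw [setIntegral_pos_iff_support_of_nonneg_ae (Eventually.of_forall fun w => hf0 _)
      hint.integrableOn]
    have hTc : Continuous fun w => T (c j, w) :=
      T.continuous.comp (continuous_const.prodMk continuous_id)
    -- A strictly feasible point of the facet with `f > 0` has a whole neighbourhood of such points
    -- in the facet, which has positive measure.
    have ho : IsOpen ((⋂ m, ⋂ _ : m ≠ j, {w : (l j).ker | l m (T (c j, w)) < c m}) ∩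
        {w | 0 < f (T (c j, w))}) :=
      (isOpen_iInter_of_finite fun m => isOpen_iInter_of_finite fun _ =>
        isOpen_lt ((l m).continuous.comp hTc) continuous_const).inter
        (isOpen_lt continuous_const (hf.comp hTc))
    have hmem : ∀ w, w ∈ ((⋂ m, ⋂ _ : m ≠ j, {w : (l j).ker | l m (T (c j, w)) < c m}) ∩
        {w | 0 < f (T (c j, w))}) ↔
        (∀ m, m ≠ j → l m (T (c j, w)) < c m) ∧ 0 < f (T (c j, w)) := fun w => by simp
    refine (ho.measure_pos ν ⟨w, (hmem w).2 ⟨hxm, hfx⟩⟩).trans_le (measure_mono fun w hw => ?_)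
    obtain ⟨h1, h2⟩ := (hmem w).1 hw
    exact ⟨h2.ne', fun m hm => (h1 m hm).le⟩

end CutIntegral

/-! ### Linear algebra modulo constants -/

section Newton

variable {N : ℕ}

/-- The vector `(1, …, 1)`. -/
noncomputable def ones (N : ℕ) : EuclideanSpace ℝ (Fin N) := WithLp.toLp 2 fun _ => 1

theorem ones_apply (i : Fin N) : ones N i = 1 := rfl

theorem inner_ones (v : EuclideanSpace ℝ (Fin N)) : inner ℝ (ones N) v = ∑ i, v i := by
  simp [PiLp.inner_apply, ones_apply]

theorem eq_zero_of_const_of_sum_eq_zero {v : EuclideanSpace ℝ (Fin N)} (hv : ∀ i j, v i = v j)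
    (hs : ∑ i, v i = 0) : v = 0 := by
  ext i
  have : ∑ j, v j = N * v i := by simp [fun j => hv j i]
  have hN : (N : ℝ) ≠ 0 := by have := i.pos; positivity
  rw [this] at hs
  simpa [hN] using hs

/-- The orthogonal projection onto the line spanned by `(1, …, 1)`. -/
noncomputable def meanProj (N : ℕ) : EuclideanSpace ℝ (Fin N) →L[ℝ] EuclideanSpace ℝ (Fin N) :=
  (N : ℝ)⁻¹ • (innerSL ℝ (ones N)).smulRight (ones N)

theorem meanProj_apply (v : EuclideanSpace ℝ (Fin N)) :
    meanProj N v = ((N : ℝ)⁻¹ * ∑ i, v i) • ones N := by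
  simp [meanProj, inner_ones, smul_smul]

theorem isSelfAdjoint_one_sub_meanProj : IsSelfAdjoint (1 - meanProj N) := by
  rw [ContinuousLinearMap.isSelfAdjoint_iff_isSymmetric]
  intro v w
  have hv : (1 - meanProj N) v = v - ((N : ℝ)⁻¹ * ∑ i, v i) • ones N := by
    simp [meanProj_apply]
  have hw : (1 - meanProj N) w = w - ((N : ℝ)⁻¹ * ∑ i, w i) • ones N := by
    simp [meanProj_apply]
  simp only [ContinuousLinearMap.coe_coe, hv, hw, inner_sub_left, inner_sub_right,
    inner_smul_left, inner_smul_right, inner_ones, real_inner_comm (ones N) v]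
  simp
  ring

/-- `B w = (B A) (B w)` lies in the range of the self-adjoint operator `B A`, which kills `ones N`;
hence it is orthogonal to `ones N`. -/
theorem IsPseudoInverse.sum_apply {A B : EuclideanSpace ℝ (Fin N) →L[ℝ] EuclideanSpace ℝ (Fin N)}
    (hB : IsPseudoInverse A B) (hA₀ : A (ones N) = 0) (w : EuclideanSpace ℝ (Fin N)) :
    ∑ i, B w i = 0 := by
  have h1 : (B * A) (B w) = B w := congrArg (fun T => T w) hB.mul_mul_right
  have h2 := (ContinuousLinearMap.isSelfAdjoint_iff_isSymmetric.1 hB.isSelfAdjoint_right)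
    (ones N) (B w)
  simp only [ContinuousLinearMap.coe_coe] at h2
  rw [h1] at h2
  simpa [inner_ones, hA₀] using h2.symm

section LinearAlgebra

variable [NeZero N] {A : EuclideanSpace ℝ (Fin N) →L[ℝ] EuclideanSpace ℝ (Fin N)}

theorem sum_meanProj (v : EuclideanSpace ℝ (Fin N)) : ∑ i, meanProj N v i = ∑ i, v i := by
  have hN : (N : ℝ) ≠ 0 := NeZero.ne _
  simp [meanProj_apply, ones_apply, hN]

theorem meanProj_ones : meanProj N (ones N) = ones N := by
  have hN : (N : ℝ) ≠ 0 := NeZero.ne _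
  simp [meanProj_apply, ones_apply, hN]

/-- A matrix whose kernel is spanned by `(1, …, 1)` and whose range is orthogonal to it becomes
invertible when the orthogonal projection onto that line is added. -/
theorem exists_inverse_add_meanProj (hA₁ : ∀ v, ∑ i, A v i = 0)
    (hker : ∀ v, A v = 0 → ∀ i j, v i = v j) :
    ∃ C : EuclideanSpace ℝ (Fin N) →L[ℝ] EuclideanSpace ℝ (Fin N),
      (A + meanProj N) * C = 1 ∧ C * (A + meanProj N) = 1 := by
  have hinj : Function.Injective (A + meanProj N).toLinearMap := by
    rw [← LinearMap.ker_eq_bot, LinearMap.ker_eq_bot']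
    intro v hv
    have hv' : A v + meanProj N v = 0 := hv
    have hs : ∑ i, v i = 0 := by
      have := congrArg (fun u : EuclideanSpace ℝ (Fin N) => ∑ i, u i) hv'
      simpa [Finset.sum_add_distrib, hA₁, sum_meanProj] using this
    have hP : meanProj N v = 0 := by simp [meanProj_apply, hs]
    rw [hP, add_zero] at hv'
    exact eq_zero_of_const_of_sum_eq_zero (hker v hv') hs
  let e := (LinearEquiv.ofInjectiveEndo _ hinj).toContinuousLinearEquiv
  have he : ∀ v, e v = (A + meanProj N) v := fun v => rfl
  refine ⟨e.symm.toContinuousLinearMap, ?_, ?_⟩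
  · ext1 v
    simpa [he] using e.apply_symm_apply v
  · ext1 v
    simpa [he] using e.symm_apply_apply v

/-- With `P` the projection onto constants, `(A + P)⁻¹ - P` works: its products with `A` on both
sides equal `1 - P`. -/
theorem exists_isPseudoInverse (hA₀ : A (ones N) = 0) (hA₁ : ∀ v, ∑ i, A v i = 0)
    (hker : ∀ v, A v = 0 → ∀ i j, v i = v j) : ∃ B, IsPseudoInverse A B := by
  obtain ⟨C, hC₁, hC₂⟩ := exists_inverse_add_meanProj hA₁ hker
  set P := meanProj N
  have hAP : A * P = 0 := by
    ext1 v
    simp [P, meanProj_apply, hA₀]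
  have hPA : P * A = 0 := by
    ext1 v
    simp [P, meanProj_apply, hA₁]
  have hPP : P * P = P := by
    ext1 v
    change meanProj N (meanProj N v) = meanProj N v
    rw [meanProj_apply v, map_smul, meanProj_ones]
  have hPC : P * C = P := by
    calc P * C = P * (A + P) * C := by rw [mul_add, hPA, hPP, zero_add]
      _ = P := by rw [mul_assoc, hC₁, mul_one]
  have hCP : C * P = P := by
    calc C * P = C * ((A + P) * P) := by rw [add_mul, hAP, hPP, zero_add]
      _ = P := by rw [← mul_assoc, hC₂, one_mul]
  have hAB : A * (C - P) = 1 - P := by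
    rw [mul_sub, hAP, sub_zero, eq_sub_iff_add_eq, ← hC₁, add_mul, hPC]
  have hBA : (C - P) * A = 1 - P := by
    rw [sub_mul, hPA, sub_zero, eq_sub_iff_add_eq, ← hC₂, mul_add, hCP]
  have hsa : IsSelfAdjoint (1 - P) := isSelfAdjoint_one_sub_meanProj
  refine ⟨C - P, ?_, ?_, by rw [hAB]; exact hsa, by rw [hBA]; exact hsa⟩
  · rw [hAB, sub_mul, one_mul, hPA, sub_zero]
  · rw [hBA, sub_mul, one_mul, mul_sub, hPC, hPP, sub_self, sub_zero]

/-- A vector of sum zero is in the range of `A`, and `A B` is the identity on that range since `A B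
A = A`. -/
theorem IsPseudoInverse.apply_apply {B : EuclideanSpace ℝ (Fin N) →L[ℝ] EuclideanSpace ℝ (Fin N)}
    (hB : IsPseudoInverse A B) (hA₁ : ∀ v, ∑ i, A v i = 0)
    (hker : ∀ v, A v = 0 → ∀ i j, v i = v j) {w : EuclideanSpace ℝ (Fin N)}
    (hw : ∑ i, w i = 0) : A (B w) = w := by
  obtain ⟨C, hC₁, -⟩ := exists_inverse_add_meanProj hA₁ hker
  have h1 : A (C w) + meanProj N (C w) = w := congrArg (fun T => T w) hC₁
  have hs : ∑ i, C w i = 0 := by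
    have := congrArg (fun u : EuclideanSpace ℝ (Fin N) => ∑ i, u i) h1
    simpa [Finset.sum_add_distrib, hA₁, sum_meanProj, hw] using this
  have h2 : A (C w) = w := by simpa [meanProj_apply, hs] using h1
  have h3 : A (B (A (C w))) = A (C w) := congrArg (fun T => T (C w)) hB.mul_mul_left
  rwa [h2] at h3

end LinearAlgebra

/-- A `C¹` map is approximated by its derivative uniformly on a compact set. -/
theorem exists_uniform_linear_approx {E F : Type*} [NormedAddCommGroup E] [NormedSpace ℝ E]
    [NormedAddCommGroup F] [NormedSpace ℝ F] {G : E → F} {A : E → E →L[ℝ] F}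
    (hG : ∀ x, HasFDerivAt G (A x) x) (hA : Continuous A) {K : Set E} (hK : IsCompact K)
    {ω : ℝ} (hω : 0 < ω) :
    ∃ δ > 0, ∀ x ∈ K, ∀ h, ‖h‖ < δ → ‖G (x + h) - G x - A x h‖ ≤ ω * ‖h‖ := by
  -- Only the base point has to be in `K`: the resulting `δ` works for every other point within `δ`
  -- of it.
  have hu := hK.uniformContinuousAt_of_continuousAt A (fun x _ => hA.continuousAt)
    (Metric.dist_mem_uniformity hω)
  obtain ⟨δ, hδ, hsub⟩ := Metric.mem_uniformity_dist.1 hu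
  refine ⟨δ, hδ, fun x hx h hh => ?_⟩
  have := (convex_ball x δ).norm_image_sub_le_of_norm_hasFDerivWithin_le' (f := G) (f' := A)
    (φ := A x) (C := ω) (x := x) (y := x + h) (fun z _ => (hG z).hasFDerivWithinAt)
    (fun z hz => by
      have := hsub (a := x) (b := z) (by rwa [dist_comm]) hx
      have h3 : dist (A x) (A z) < ω := this
      rw [dist_comm, dist_eq_norm] at h3
      exact h3.le)
    (Metric.mem_ball_self hδ) (by simpa using hh)
  simpa using this

/-! ### The damped Newton method for an abstract mass map -/

variable {G : EuclideanSpace ℝ (Fin N) → EuclideanSpace ℝ (Fin N)}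
  {A : EuclideanSpace ℝ (Fin N) → EuclideanSpace ℝ (Fin N) →L[ℝ] EuclideanSpace ℝ (Fin N)}

/-- What the damped Newton algorithm needs to know of the map `G`. -/
structure IsMassLike (G : EuclideanSpace ℝ (Fin N) → EuclideanSpace ℝ (Fin N))
    (A : EuclideanSpace ℝ (Fin N) → EuclideanSpace ℝ (Fin N) →L[ℝ] EuclideanSpace ℝ (Fin N)) :
    Prop where
  hasFDerivAt : ∀ ψ, HasFDerivAt G (A ψ) ψ
  continuous : Continuous A
  add_ones : ∀ ψ (c : ℝ), G (ψ + c • ones N) = G ψ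
  sum_eq_one : ∀ ψ, ∑ i, G ψ i = 1
  ker_le : ∀ ψ, (∀ i, 0 < G ψ i) → ∀ v, A ψ v = 0 → ∀ i j, v i = v j
  bounded : ∃ R : ℝ, ∀ ψ, (∀ i, 0 < G ψ i) → ∀ i j, ψ i - ψ j ≤ R

namespace IsMassLike

theorem apply_ones (h : IsMassLike G A) (ψ : EuclideanSpace ℝ (Fin N)) : A ψ (ones N) = 0 := by
  have h1 : HasDerivAt (fun c : ℝ => ψ + c • ones N) (ones N) 0 := by
    simpa using ((hasDerivAt_id (0 : ℝ)).smul_const (ones N)).const_add ψ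
  have h2 : HasFDerivAt G (A ψ) (ψ + (0 : ℝ) • ones N) := by simpa using h.hasFDerivAt ψ
  have h3 := h2.comp_hasDerivAt (0 : ℝ) h1
  have h4 : G ∘ (fun c : ℝ => ψ + c • ones N) = fun _ => G ψ := funext fun c => h.add_ones ψ c
  rw [h4] at h3
  exact h3.unique (hasDerivAt_const _ _)

theorem sum_apply (h : IsMassLike G A) (ψ v : EuclideanSpace ℝ (Fin N)) :
    ∑ i, A ψ v i = 0 := by
  have h1 := (innerSL ℝ (ones N)).hasFDerivAt.comp ψ (h.hasFDerivAt ψ)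
  have h2 : (innerSL ℝ (ones N)) ∘ G = fun _ => (1 : ℝ) := funext fun ψ => by
    simp [inner_ones, h.sum_eq_one]
  rw [h2] at h1
  have h3 := congrArg (fun T => T v) (h1.unique (hasFDerivAt_const _ _))
  simpa [inner_ones] using h3

theorem continuous_map (h : IsMassLike G A) : Continuous G :=
  continuous_iff_continuousAt.2 fun ψ => (h.hasFDerivAt ψ).continuousAt

theorem fderiv_add_ones (h : IsMassLike G A) (ψ : EuclideanSpace ℝ (Fin N)) (c : ℝ) :
    A (ψ + c • ones N) = A ψ := by
  have h1 : HasFDerivAt (fun x => G (x + c • ones N)) (A (ψ + c • ones N)) ψ :=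
    (hasFDerivAt_comp_add_right (c • ones N)).2 (h.hasFDerivAt (ψ + c • ones N))
  have h2 : (fun x => G (x + c • ones N)) = G := funext fun x => h.add_ones x c
  rw [h2] at h1
  exact h1.unique (h.hasFDerivAt ψ)

/-- Fixing the sum of the weights to be zero removes the translation invariance; the bound on
differences of weights then bounds the weights themselves. -/
theorem isCompact_superlevel (h : IsMassLike G A) {ε : ℝ} (hε : 0 < ε) :
    IsCompact {ψ : EuclideanSpace ℝ (Fin N) | ∑ i, ψ i = 0 ∧ ∀ i, ε ≤ G ψ i} := by
  have hG := h.continuous_map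
  refine Metric.isCompact_of_isClosed_isBounded ?_ ?_
  · have hset : {ψ : EuclideanSpace ℝ (Fin N) | ∑ i, ψ i = 0 ∧ ∀ i, ε ≤ G ψ i}
        = {ψ | ∑ i, ψ i = 0} ∩ ⋂ i, {ψ | ε ≤ G ψ i} := by ext; simp
    rw [hset]
    exact (isClosed_eq (by fun_prop) continuous_const).inter
      (isClosed_iInter fun i => isClosed_le continuous_const (by fun_prop))
  · obtain ⟨R, hR⟩ := h.bounded
    refine isBounded_iff_forall_norm_le.2 ⟨√(∑ _ : Fin N, R ^ 2), fun ψ hψ => ?_⟩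
    obtain ⟨hs, hψ⟩ := hψ
    rw [EuclideanSpace.norm_eq]
    refine Real.sqrt_le_sqrt (Finset.sum_le_sum fun i _ => ?_)
    have hpos : ∀ i, 0 < G ψ i := fun i => hε.trans_le (hψ i)
    have hN : (0 : ℝ) < N := by have := i.pos; positivity
    have h1 : (N : ℝ) * ψ i ≤ N * R := by
      have := Finset.sum_le_sum fun j (_ : j ∈ Finset.univ) => hR ψ hpos i j
      simpa [hs] using this
    have h2 : -((N : ℝ) * ψ i) ≤ N * R := by
      have := Finset.sum_le_sum fun j (_ : j ∈ Finset.univ) => hR ψ hpos j i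
      simpa [hs] using this
    have h3 : |ψ i| ≤ R := abs_le.2 ⟨by nlinarith, by nlinarith⟩
    rw [Real.norm_eq_abs]
    gcongr

/-- The derivative is uniformly invertible on superlevel sets. -/
theorem exists_norm_le (h : IsMassLike G A) {ε : ℝ} (hε : 0 < ε) :
    ∃ C > 0, ∀ ψ, ∑ i, ψ i = 0 → (∀ i, ε ≤ G ψ i) → ∀ v, ∑ i, v i = 0 → ‖v‖ ≤ C * ‖A ψ v‖ := by
  have hK := h.isCompact_superlevel hε
  set K := {ψ : EuclideanSpace ℝ (Fin N) | ∑ i, ψ i = 0 ∧ ∀ i, ε ≤ G ψ i}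
  have hS : IsCompact (Metric.sphere (0 : EuclideanSpace ℝ (Fin N)) 1 ∩ {v | ∑ i, v i = 0}) :=
    (isCompact_sphere _ _).inter_right (isClosed_eq (by fun_prop) continuous_const)
  have hc : Continuous fun p : EuclideanSpace ℝ (Fin N) × EuclideanSpace ℝ (Fin N) =>
      ‖A p.1 p.2‖ := by
    have := h.continuous
    fun_prop
  obtain ⟨m, hm, hmin⟩ : ∃ m > 0, ∀ p ∈ K ×ˢ (Metric.sphere (0 : EuclideanSpace ℝ (Fin N)) 1 ∩
      {v | ∑ i, v i = 0}), m ≤ ‖A p.1 p.2‖ := by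
    rcases (K ×ˢ (Metric.sphere (0 : EuclideanSpace ℝ (Fin N)) 1 ∩
      {v | ∑ i, v i = 0})).eq_empty_or_nonempty with he | hne
    · exact ⟨1, one_pos, by simp [he]⟩
    -- The minimum is attained, and it is nonzero because a kernel vector of sum zero vanishes.
    · obtain ⟨p, hp, hpm⟩ := (hK.prod hS).exists_isMinOn hne hc.continuousOn
      refine ⟨‖A p.1 p.2‖, ?_, fun q hq => hpm hq⟩
      rw [gt_iff_lt, norm_pos_iff]
      intro h0
      have := eq_zero_of_const_of_sum_eq_zero
        (h.ker_le p.1 (fun i => hε.trans_le (hp.1.2 i)) p.2 h0) hp.2.2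
      have h1 : ‖p.2‖ = 1 := by simpa using hp.2.1
      simp [this] at h1
  refine ⟨m⁻¹, inv_pos.2 hm, fun ψ hψ hψ' v hv => ?_⟩
  by_cases hv0 : v = 0
  · simp [hv0]
  have hn : 0 < ‖v‖ := norm_pos_iff.2 hv0
  have := hmin (ψ, ‖v‖⁻¹ • v) ⟨⟨hψ, hψ'⟩, by simp [norm_smul, hn.ne'], by
    simp [← Finset.mul_sum, hv]⟩
  simp only [map_smul, norm_smul, norm_inv, norm_norm] at this
  rw [inv_mul_eq_div, le_div_iff₀ hn] at this
  rw [inv_mul_eq_div, le_div_iff₀ hm]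
  linarith

/-- Damped Newton steps are admissible up to a step size that is uniform on superlevel sets. -/
theorem exists_stepSize (h : IsMassLike G A) {ν : EuclideanSpace ℝ (Fin N)} {ε : ℝ} (hε : 0 < ε)
    (hν : ∀ i, 2 * ε ≤ ν i) :
    ∃ t₀ > 0, ∀ ψ, (∀ i, ε ≤ G ψ i) → ∀ v, ∑ i, v i = 0 → A ψ v = -(G ψ - ν) →
      ∀ t, 0 ≤ t → t ≤ 1 → t ≤ t₀ →
        (∀ i, ε ≤ G (ψ + t • v) i) ∧ ‖G (ψ + t • v) - ν‖ ≤ (1 - t / 2) * ‖G ψ - ν‖ := by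
  have hK := h.isCompact_superlevel hε
  obtain ⟨C, hC, hinv⟩ := h.exists_norm_le hε
  obtain ⟨R, hR⟩ := hK.exists_bound_of_continuousOn (f := fun ψ => G ψ - ν)
    (h.continuous_map.sub continuous_const).continuousOn
  set R' := max R 1
  have hR' : 0 < R' := lt_max_of_lt_right one_pos
  -- The first bound makes the linearization error at most `t / 2` times the residual, the second
  -- makes it at most `t * ε`. Both use `‖v‖ ≤ C * r` with `r ≤ R'`.
  set ω := min (1 / (2 * C)) (ε / (C * R'))
  have hω : 0 < ω := by positivity
  obtain ⟨δ, hδ, happ⟩ := exists_uniform_linear_approx h.hasFDerivAt h.continuous hK hω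
  refine ⟨δ / (2 * (C * R')), by positivity, fun ψ' hψ' v hv hAv t ht ht1 ht0 => ?_⟩
  -- Translate by a constant into the compact normalized set; neither `G` nor its derivative
  -- changes.
  obtain ⟨c, ψ, hs, rfl⟩ : ∃ (c : ℝ) (ψ : EuclideanSpace ℝ (Fin N)), ∑ i, ψ i = 0 ∧
      ψ' = ψ + c • ones N := by
    rcases N.eq_zero_or_pos with rfl | hN
    · exact ⟨0, ψ', by simp, by simp⟩
    · have hN' : (N : ℝ) ≠ 0 := by positivity
      refine ⟨(N : ℝ)⁻¹ * ∑ i, ψ' i, ψ' - ((N : ℝ)⁻¹ * ∑ i, ψ' i) • ones N, ?_, by simp⟩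
      simp [ones_apply, hN']
  have hcomm : ψ + c • ones N + t • v = ψ + t • v + c • ones N := by abel
  rw [hcomm]
  rw [h.fderiv_add_ones] at hAv
  simp only [h.add_ones] at hψ' hAv ⊢
  set r := ‖G ψ - ν‖
  have hr0 : 0 ≤ r := norm_nonneg _
  have hrR : r ≤ R' := (hR ψ ⟨hs, hψ'⟩).trans (le_max_left _ _)
  have hvn : ‖v‖ ≤ C * r := by
    have := hinv ψ hs hψ' v hv
    rwa [hAv, norm_neg] at this
  have htv : ‖t • v‖ = t * ‖v‖ := by rw [norm_smul, Real.norm_of_nonneg ht]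
  have hsmall : ‖t • v‖ < δ := by
    rw [htv]
    calc t * ‖v‖ ≤ δ / (2 * (C * R')) * (C * R') := by gcongr; exact hvn.trans (by gcongr)
      _ = δ / 2 := by field_simp
      _ < δ := by linarith
  set e := G (ψ + t • v) - G ψ - A ψ (t • v) with he
  have hen : ‖e‖ ≤ ω * (t * (C * r)) := by
    have := happ ψ ⟨hs, hψ'⟩ _ hsmall
    rw [htv] at this
    exact this.trans (by gcongr)
  have he1 : ‖e‖ ≤ t / 2 * r := by
    refine hen.trans ?_
    calc ω * (t * (C * r)) ≤ 1 / (2 * C) * (t * (C * r)) := by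
          gcongr; exact min_le_left _ _
      _ = t / 2 * r := by field_simp
  have he2 : ‖e‖ ≤ t * ε := by
    refine hen.trans ?_
    calc ω * (t * (C * r)) ≤ ε / (C * R') * (t * (C * R')) := by
          gcongr; exact min_le_right _ _
      _ = t * ε := by field_simp
  have hexp : G (ψ + t • v) = G ψ - t • (G ψ - ν) + e := by
    rw [he, map_smul, hAv, smul_neg]; abel
  constructor
  · intro i
    have h1 : |e i| ≤ ‖e‖ := PiLp.norm_apply_le e i
    have h2 := (abs_le.1 (h1.trans he2)).1
    rw [hexp]
    have h3 := hψ' i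
    have h4 := hν i
    simp only [PiLp.add_apply, PiLp.sub_apply, PiLp.smul_apply, smul_eq_mul]
    -- The new mass is `(1 - t) G_i + t ν_i + e_i ≥ (1 - t) ε + 2 t ε - t ε = ε`; this is where the
    -- factor 2 in `2 * ε ≤ ν i` is spent.
    nlinarith [mul_le_mul_of_nonneg_left h4 ht, mul_le_mul_of_nonneg_left h3 (sub_nonneg.2 ht1)]
  · have h5 : G (ψ + t • v) - ν = (1 - t) • (G ψ - ν) + e := by
      rw [hexp, sub_smul, one_smul]; abel
    rw [h5]
    calc ‖(1 - t) • (G ψ - ν) + e‖ ≤ ‖(1 - t) • (G ψ - ν)‖ + ‖e‖ := norm_add_le _ _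
      _ ≤ (1 - t) * r + t / 2 * r := by
          rw [norm_smul, Real.norm_of_nonneg (sub_nonneg.2 ht1)]; gcongr
      _ = (1 - t / 2) * r := by ring

variable {ν : EuclideanSpace ℝ (Fin N)} {ε₀ : ℝ}

/-- The residual has sum zero because both masses total 1, so the pseudo-inverse solves the Newton
equation exactly. -/
theorem newtonDirection_spec [NeZero N] (h : IsMassLike G A) (hν : ∑ i, ν i = 1)
    {ψ v : EuclideanSpace ℝ (Fin N)} (hψ : ∀ i, 0 < G ψ i) (hv : IsNewtonDirection G ν ψ v) :
    ∑ i, v i = 0 ∧ A ψ v = -(G ψ - ν) := by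
  obtain ⟨A', B, hA', hB, rfl⟩ := hv
  obtain rfl := hA'.unique (h.hasFDerivAt ψ)
  have hw : ∑ i, (G ψ - ν) i = 0 := by simp [h.sum_eq_one, hν]
  refine ⟨?_, ?_⟩
  · simp [hB.sum_apply (h.apply_ones ψ)]
  · rw [map_neg, hB.apply_apply (h.sum_apply ψ) (h.ker_le ψ hψ) hw]

theorem exists_newtonDirection [NeZero N] (h : IsMassLike G A)
    {ψ : EuclideanSpace ℝ (Fin N)} (hψ : ∀ i, 0 < G ψ i) : ∃ v, IsNewtonDirection G ν ψ v := by
  obtain ⟨B, hB⟩ := exists_isPseudoInverse (h.apply_ones ψ) (h.sum_apply ψ) (h.ker_le ψ hψ)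
  exact ⟨_, A ψ, B, h.hasFDerivAt ψ, hB, rfl⟩

theorem newtonDirection_unique [NeZero N] (h : IsMassLike G A) (hν : ∑ i, ν i = 1)
    {ψ v w : EuclideanSpace ℝ (Fin N)} (hψ : ∀ i, 0 < G ψ i) (hv : IsNewtonDirection G ν ψ v)
    (hw : IsNewtonDirection G ν ψ w) : v = w := by
  obtain ⟨hv1, hv2⟩ := h.newtonDirection_spec hν hψ hv
  obtain ⟨hw1, hw2⟩ := h.newtonDirection_spec hν hψ hw
  refine sub_eq_zero.1 (eq_zero_of_const_of_sum_eq_zero (h.ker_le ψ hψ _ ?_) ?_)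
  · rw [map_sub, hv2, hw2, sub_self]
  · simp [hv1, hw1]

theorem step_unique [NeZero N] (h : IsMassLike G A) (hν : ∑ i, ν i = 1)
    {ψ φ φ' : EuclideanSpace ℝ (Fin N)} (hψ : ∀ i, 0 < G ψ i)
    (hφ : IsDampedNewtonStep G ν ε₀ ψ φ) (hφ' : IsDampedNewtonStep G ν ε₀ ψ φ') : φ = φ' := by
  obtain ⟨v, l, hv, hl, rfl⟩ := hφ
  obtain ⟨v', l', hv', hl', rfl⟩ := hφ'
  obtain rfl := h.newtonDirection_unique hν hψ hv hv'
  rw [hl.unique hl']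

/-- Fix `L` with `2⁻ᴸ` below the uniform step size. Then `L` is always admissible, so the least
admissible exponent is at most `L` and the rate `τ = 2⁻ᴸ` holds at every step. -/
theorem exists_rate [NeZero N] (h : IsMassLike G A) (hν : ∑ i, ν i = 1) (hε : 0 < ε₀)
    (hν₂ : ∀ i, 2 * ε₀ ≤ ν i) :
    ∃ τ : ℝ, 0 < τ ∧ τ ≤ 1 ∧ ∀ ψ, (∀ i, ε₀ ≤ G ψ i) →
      (∃ φ, IsDampedNewtonStep G ν ε₀ ψ φ) ∧
      ∀ φ, IsDampedNewtonStep G ν ε₀ ψ φ →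
        (∀ i, ε₀ ≤ G φ i) ∧ ‖G φ - ν‖ ≤ (1 - τ / 2) * ‖G ψ - ν‖ := by
  obtain ⟨t₀, ht₀, hstep⟩ := h.exists_stepSize hε hν₂
  obtain ⟨L, hL⟩ := exists_pow_lt_of_lt_one ht₀ (by norm_num : (2⁻¹ : ℝ) < 1)
  have hL1 : (2⁻¹ : ℝ) ^ L ≤ 1 := pow_le_one₀ (by norm_num) (by norm_num)
  have hadm : ∀ ψ, (∀ i, ε₀ ≤ G ψ i) → ∀ v, IsNewtonDirection G ν ψ v →
      L ∈ admissibleExponents G ν ε₀ ψ v := by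
    intro ψ hψ v hv
    obtain ⟨hv1, hv2⟩ := h.newtonDirection_spec hν (fun i => hε.trans_le (hψ i)) hv
    obtain ⟨h1, h2⟩ := hstep ψ hψ v hv1 hv2 _ (by positivity) hL1 hL.le
    refine ⟨h1, h2.trans_eq ?_⟩
    rw [pow_succ]; ring
  refine ⟨(2⁻¹ : ℝ) ^ L, by positivity, hL1, fun ψ hψ => ⟨?_, ?_⟩⟩
  · obtain ⟨v, hv⟩ := h.exists_newtonDirection (ν := ν) (fun i => hε.trans_le (hψ i))
    have hne : (admissibleExponents G ν ε₀ ψ v).Nonempty := ⟨L, hadm ψ hψ v hv⟩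
    exact ⟨_, v, sInf (admissibleExponents G ν ε₀ ψ v), hv,
      ⟨Nat.sInf_mem hne, fun l hl => Nat.sInf_le hl⟩, rfl⟩
  · rintro φ ⟨v, l, hv, hl, rfl⟩
    have hlL : l ≤ L := hl.2 (hadm ψ hψ v hv)
    refine ⟨hl.1.1, hl.1.2.trans ?_⟩
    have : (2⁻¹ : ℝ) ^ L ≤ (2⁻¹ : ℝ) ^ l :=
      pow_le_pow_of_le_one (by norm_num) (by norm_num) hlL
    refine mul_le_mul_of_nonneg_right ?_ (norm_nonneg _)
    rw [pow_succ]
    linarith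

/-- Global convergence of the damped Newton algorithm with a uniform linear rate. -/
theorem dampedNewton_converges [NeZero N] (h : IsMassLike G A) (hν : ∑ i, ν i = 1) (hε : 0 < ε₀)
    (hν₂ : ∀ i, 2 * ε₀ ≤ ν i) :
    ∃ τ : ℝ, 0 < τ ∧ τ ≤ 1 ∧
      ∀ ψ₀ : EuclideanSpace ℝ (Fin N), (∀ i, ε₀ ≤ G ψ₀ i) → ∀ η : ℝ, 0 < η →
        ∃ T : ℕ,
          (∃ ψ : ℕ → EuclideanSpace ℝ (Fin N),
            IsDampedNewtonRun G ν ε₀ η ψ₀ T ψ ∧ ‖G (ψ T) - ν‖ < η) ∧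
          ∀ (n : ℕ) (ψ : ℕ → EuclideanSpace ℝ (Fin N)),
            IsDampedNewtonRun G ν ε₀ η ψ₀ n ψ →
            n ≤ T ∧ ∀ k < n, ‖G (ψ (k + 1)) - ν‖ ≤ (1 - τ / 2) * ‖G (ψ k) - ν‖ := by
  obtain ⟨τ, hτ, hτ1, hrate⟩ := h.exists_rate hν hε hν₂
  refine ⟨τ, hτ, hτ1, fun ψ₀ hψ₀ η hη => ?_⟩
  have hex : ∀ ψ, ∃ φ, (∀ i, ε₀ ≤ G ψ i) → IsDampedNewtonStep G ν ε₀ ψ φ := fun ψ => by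
    by_cases hψ : ∀ i, ε₀ ≤ G ψ i
    · obtain ⟨φ, hφ⟩ := (hrate ψ hψ).1
      exact ⟨φ, fun _ => hφ⟩
    · exact ⟨ψ, fun h' => absurd h' hψ⟩
  choose f hf using hex
  have hgood : ∀ k, ∀ i, ε₀ ≤ G (f^[k] ψ₀) i := by
    intro k
    induction k with
    | zero => exact hψ₀
    | succ k ih =>
      rw [Function.iterate_succ_apply']
      exact ((hrate _ ih).2 _ (hf _ ih)).1
  have hcontr : ∀ k, ‖G (f^[k + 1] ψ₀) - ν‖ ≤ (1 - τ / 2) * ‖G (f^[k] ψ₀) - ν‖ := by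
    intro k
    rw [Function.iterate_succ_apply']
    exact ((hrate _ (hgood k)).2 _ (hf _ (hgood k))).2
  have hgeom : ∀ k, ‖G (f^[k] ψ₀) - ν‖ ≤ (1 - τ / 2) ^ k * ‖G ψ₀ - ν‖ := by
    intro k
    induction k with
    | zero => simp
    | succ k ih =>
      refine (hcontr k).trans ?_
      rw [pow_succ', mul_assoc]
      exact mul_le_mul_of_nonneg_left ih (by linarith)
  have hbelow : ∃ k, ‖G (f^[k] ψ₀) - ν‖ < η := by
    have ht : Tendsto (fun k : ℕ => (1 - τ / 2) ^ k * ‖G ψ₀ - ν‖) atTop (𝓝 (0 * ‖G ψ₀ - ν‖)) :=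
      (tendsto_pow_atTop_nhds_zero_of_lt_one (by linarith) (by linarith)).mul_const _
    rw [zero_mul] at ht
    obtain ⟨k, hk⟩ := (ht.eventually (gt_mem_nhds hη)).exists
    exact ⟨k, (hgeom k).trans_lt hk⟩
  classical
  refine ⟨Nat.find hbelow, ⟨fun k => f^[k] ψ₀, ⟨rfl, fun k hk => ⟨?_, ?_⟩⟩, Nat.find_spec hbelow⟩,
    fun n ψ hrun => ?_⟩
  · exact not_lt.1 (Nat.find_min hbelow hk)
  · simp only [Function.iterate_succ_apply']
    exact hf _ (hgood k)
  -- Steps are unique, so every run follows the constructed iteration and cannot continue past the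
  -- first residual below `η`.
  · have heq : ∀ k ≤ n, ψ k = f^[k] ψ₀ := by
      intro k
      induction k with
      | zero => exact fun _ => hrun.1
      | succ k ih =>
        intro hk
        have hs := (hrun.2 k hk).2
        rw [ih (by omega)] at hs
        rw [Function.iterate_succ_apply']
        exact h.step_unique hν (fun i => hε.trans_le (hgood k i)) hs (hf _ (hgood k))
    refine ⟨?_, fun k hk => ?_⟩
    · by_contra! hlt
      have := (hrun.2 _ hlt).1
      rw [heq _ hlt.le] at this
      exact absurd (Nat.find_spec hbelow) (not_lt.2 this)
    · rw [heq _ hk, heq _ hk.le]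
      exact hcontr k

end IsMassLike

end Newton

/-! ### Consequences of generic position -/

section Generic

variable {d N k : ℕ} {y : Fin N → EuclideanSpace ℝ (Fin d)}
  {σ : Affine.Simplex ℝ (EuclideanSpace ℝ (Fin d)) k}

theorem dim_le (σ : Affine.Simplex ℝ (EuclideanSpace ℝ (Fin d)) k) : k ≤ d := by
  have h := σ.independent.card_le_finrank_succ
  have h2 := Submodule.finrank_le (vectorSpan ℝ (Set.range σ.points))
  simp only [Fintype.card_fin, finrank_euclideanSpace] at h h2
  omega

/-- A vector along an `l`-dimensional face whose inner products with `l + 1` of the points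
coincide vanishes. -/
theorem IsGenericFor.eq_zero (hy : IsGenericFor y σ) {I : Finset (Fin N)}
    {J : Finset (Fin (k + 1))} (hIJ : I.card = J.card) {t : Fin (k + 1) → ℝ}
    (ht : ∀ m, m ∉ J → t m = 0) (hs : ∑ m, t m = 0) {κ : ℝ}
    (hκ : ∀ i ∈ I, inner ℝ (∑ m, t m • σ.points m) (y i) = κ) : ∀ m, t m = 0 := by
  have hsJ : ∑ m ∈ J, t m = 0 := by
    rw [← hs]
    exact Finset.sum_subset (Finset.subset_univ _) fun m _ hm => ht m hm
  have huJ : ∑ m, t m • σ.points m = ∑ m ∈ J, t m • σ.points m :=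
    (Finset.sum_subset (Finset.subset_univ _) fun m _ hm => by simp [ht m hm]).symm
  have main : ∑ m, t m • σ.points m = 0 := by
    -- For at least two vertices, use genericity with `p = l`, where the intersection has dimension
    -- 0. With at most one vertex, the zero sum of the weights suffices.
    rcases Nat.lt_or_ge 1 J.card with hJ | hJ
    · obtain ⟨l, hl⟩ : ∃ l, J.card = l + 1 := ⟨J.card - 1, by omega⟩
      have hlI : I.card = l + 1 := hIJ.trans hl
      have h1 : l + 1 ≤ N := by simpa [hlI] using I.card_le_univ
      have h2 : l + 1 ≤ k + 1 := by simpa [hl] using J.card_le_univ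
      have h3 := dim_le σ
      set i := I.orderEmbOfFin hlI
      set j := J.orderEmbOfFin hl
      have hdim := hy l l (by omega) (by omega) (by omega) (by omega) i j i.injective j.injective
      rw [Nat.sub_self, Submodule.finrank_eq_zero, eq_bot_iff] at hdim
      have hsum : ∀ F : Fin (k + 1) → EuclideanSpace ℝ (Fin d),
          ∑ m ∈ J, F m = ∑ b, F (j b) := fun F => by
        rw [← J.map_orderEmbOfFin_univ hl, Finset.sum_map]; rfl
      have hsum' : ∑ m ∈ J, t m = ∑ b, t (j b) := by
        rw [← J.map_orderEmbOfFin_univ hl, Finset.sum_map]; rfl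
      have hu : ∑ m, t m • σ.points m
          = ∑ b : Fin l, t (j b.succ) • (σ.points (j b.succ) - σ.points (j 0)) := by
        rw [huJ, hsum, Fin.sum_univ_succ]
        simp only [smul_sub, Finset.sum_sub_distrib, ← Finset.sum_smul]
        rw [hsum', Fin.sum_univ_succ] at hsJ
        have : ∑ b : Fin l, t (j b.succ) = -t (j 0) := by linarith
        rw [this, neg_smul]
        abel
      refine (Submodule.mem_bot ℝ).1 (hdim ⟨?_, ?_⟩)
      · rw [SetLike.mem_coe, Submodule.mem_orthogonal']
        intro w hw
        induction hw using Submodule.span_induction with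
        | mem w hw =>
          obtain ⟨a, rfl⟩ := hw
          rw [inner_sub_right, hκ _ (I.orderEmbOfFin_mem hlI _), hκ _ (I.orderEmbOfFin_mem hlI _),
            sub_self]
        | zero => simp
        | add w w' _ _ h h' => rw [inner_add_right, h, h', add_zero]
        | smul a w _ h => rw [inner_smul_right, h, mul_zero]
      · rw [hu]
        exact Submodule.sum_mem _ fun b _ => Submodule.smul_mem _ _
          (Submodule.subset_span ⟨b, rfl⟩)
    · rw [huJ]
      refine Finset.sum_eq_zero fun m hm => ?_
      have hJm : J = {m} := Finset.eq_singleton_iff_unique_mem.2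
        ⟨hm, fun m' hm' => Finset.card_le_one.1 hJ m' hm' m hm⟩
      rw [hJm, Finset.sum_singleton] at hsJ
      simp [hsJ]
  exact fun m => σ.independent.eq_zero_of_sum_eq_zero hs main m (Finset.mem_univ m)

/-- Along an `l`-dimensional face the inner products with `l + 1` of the points can be prescribed
up to a common constant. -/
theorem IsGenericFor.exists_weights (hy : IsGenericFor y σ) {I : Finset (Fin N)}
    {J : Finset (Fin (k + 1))} (hIJ : I.card = J.card) (hI : I.Nonempty) (c : Fin N → ℝ) :
    ∃ t : Fin (k + 1) → ℝ, (∀ m, m ∉ J → t m = 0) ∧ ∑ m, t m = 0 ∧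
      ∃ κ, ∀ i ∈ I, inner ℝ (∑ m, t m • σ.points m) (y i) = c i + κ := by
  classical
  let ext : (J → ℝ) →ₗ[ℝ] (Fin (k + 1) → ℝ) := LinearMap.pi fun m =>
    if h : m ∈ J then LinearMap.proj ⟨m, h⟩ else 0
  have ext_of : ∀ t m, m ∉ J → ext t m = 0 := fun t m hm => by simp [ext, hm]
  have ext_in : ∀ t (m : J), ext t m = t m := fun t m => by simp [ext]
  let u : (J → ℝ) →ₗ[ℝ] EuclideanSpace ℝ (Fin d) :=
    (∑ m, (LinearMap.proj m : (Fin (k + 1) → ℝ) →ₗ[ℝ] ℝ).smulRight (σ.points m)) ∘ₗ ext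
  have hu : ∀ t, u t = ∑ m, ext t m • σ.points m := fun t => by simp [u]
  -- A square system in the weights and the common constant. It is injective by
  -- `IsGenericFor.eq_zero`, with `I` nonempty to pin down the constant, hence surjective.
  let T : ((J → ℝ) × ℝ) →ₗ[ℝ] ((I → ℝ) × ℝ) := LinearMap.prod
    (LinearMap.pi fun i => (innerₛₗ ℝ (y i)) ∘ₗ u ∘ₗ LinearMap.fst ℝ _ _ - LinearMap.snd ℝ _ _)
    ((∑ m, (LinearMap.proj m : (Fin (k + 1) → ℝ) →ₗ[ℝ] ℝ)) ∘ₗ ext ∘ₗ LinearMap.fst ℝ _ _)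
  have hT1 : ∀ p i, (T p).1 i = inner ℝ (u p.1) (y i) - p.2 := fun p i => by
    simp [T, real_inner_comm]
  have hT2 : ∀ p, (T p).2 = ∑ m, ext p.1 m := fun p => by simp [T]
  have hinj : Function.Injective T := by
    rw [← LinearMap.ker_eq_bot, LinearMap.ker_eq_bot']
    rintro ⟨t, κ⟩ h0
    have h1 : ∀ i ∈ I, inner ℝ (u t) (y i) = κ := fun i hi => by
      have := hT1 (t, κ) ⟨i, hi⟩
      rw [h0] at this
      simp only [Prod.fst_zero, Pi.zero_apply] at this
      linarith
    have h2 : ∑ m, ext t m = 0 := by rw [← hT2 (t, κ), h0]; rfl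
    have h3 := hy.eq_zero hIJ (ext_of t) h2 (κ := κ) (fun i hi => by rw [← hu]; exact h1 i hi)
    have ht : t = 0 := by
      ext m
      exact (ext_in t m).symm.trans (h3 m)
    obtain ⟨i, hi⟩ := hI
    have := h1 i hi
    rw [ht, map_zero, inner_zero_left] at this
    rw [ht, ← this]
    rfl
  have hsurj : Function.Surjective T :=
    (LinearMap.injective_iff_surjective_of_finrank_eq_finrank (by simp [hIJ])).1 hinj
  obtain ⟨⟨t, κ⟩, htκ⟩ := hsurj (fun i => c i, 0)
  refine ⟨ext t, ext_of t, by rw [← hT2 (t, κ), htκ], κ, fun i hi => ?_⟩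
  have := hT1 (t, κ) ⟨i, hi⟩
  rw [htκ] at this
  rw [← hu]
  simp only at this
  linarith

end Generic

/-! ### Affine coordinates on a simplex -/

section Simplex

variable {d k : ℕ} (σ : Affine.Simplex ℝ (EuclideanSpace ℝ (Fin d)) k)

/-- The linear part of the affine parametrization of a simplex. -/
noncomputable def paramLin : EuclideanSpace ℝ (Fin k) →L[ℝ] EuclideanSpace ℝ (Fin d) :=
  ∑ i : Fin k, (EuclideanSpace.proj i).smulRight (σ.points i.succ - σ.points 0)

/-- The affine parametrization of the affine span of a simplex. -/
noncomputable def param (t : EuclideanSpace ℝ (Fin k)) : EuclideanSpace ℝ (Fin d) :=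
  σ.points 0 + paramLin σ t

/-- The linear parts of the barycentric coordinates. -/
noncomputable def baryLin (m : Fin (k + 1)) : EuclideanSpace ℝ (Fin k) →L[ℝ] ℝ :=
  Fin.cases (-∑ i : Fin k, EuclideanSpace.proj i) (fun i => EuclideanSpace.proj i) m

/-- The values of the barycentric coordinates at the origin. -/
def baryConst (m : Fin (k + 1)) : ℝ := Fin.cases 1 (fun _ => 0) m

/-- The point with given barycentric coordinates. -/
noncomputable def ofWeights (w : Fin (k + 1) → ℝ) : EuclideanSpace ℝ (Fin k) :=
  WithLp.toLp 2 fun i => w i.succ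

variable {σ}

theorem paramLin_apply (t : EuclideanSpace ℝ (Fin k)) :
    paramLin σ t = ∑ i : Fin k, t i • (σ.points i.succ - σ.points 0) := by
  simp [paramLin]

theorem baryLin_ofWeights {w : Fin (k + 1) → ℝ} (hw : ∑ m, w m = 0) (m : Fin (k + 1)) :
    baryLin m (ofWeights w) = w m := by
  rw [Fin.sum_univ_succ] at hw
  cases m using Fin.cases with
  | zero => simp [baryLin, ofWeights]; linarith
  | succ i => simp [baryLin, ofWeights]

theorem bary_ofWeights {w : Fin (k + 1) → ℝ} (hw : ∑ m, w m = 1) (m : Fin (k + 1)) :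
    baryConst m + baryLin m (ofWeights w) = w m := by
  rw [Fin.sum_univ_succ] at hw
  cases m using Fin.cases with
  | zero => simp [baryLin, ofWeights, baryConst]; linarith
  | succ i => simp [baryLin, ofWeights, baryConst]

theorem sum_bary (t : EuclideanSpace ℝ (Fin k)) : ∑ m, (baryConst m + baryLin m t) = 1 := by
  rw [Fin.sum_univ_succ]
  simp [baryLin, baryConst]

theorem paramLin_ofWeights {w : Fin (k + 1) → ℝ} (hw : ∑ m, w m = 0) :
    paramLin σ (ofWeights w) = ∑ m, w m • σ.points m := by
  rw [Fin.sum_univ_succ] at hw ⊢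
  have : ∑ i : Fin k, w i.succ = -w 0 := by linarith
  simp only [paramLin_apply, ofWeights, smul_sub, Finset.sum_sub_distrib, ← Finset.sum_smul, this]
  rw [neg_smul]
  abel

theorem param_ofWeights {w : Fin (k + 1) → ℝ} (hw : ∑ m, w m = 1) :
    param σ (ofWeights w) = ∑ m, w m • σ.points m := by
  rw [Fin.sum_univ_succ] at hw ⊢
  have : ∑ i : Fin k, w i.succ = 1 - w 0 := by linarith
  simp only [param, paramLin_apply, ofWeights, smul_sub, Finset.sum_sub_distrib, ← Finset.sum_smul,
    this]
  rw [sub_smul, one_smul]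
  abel

theorem param_eq_sum (t : EuclideanSpace ℝ (Fin k)) :
    param σ t = ∑ m, (baryConst m + baryLin m t) • σ.points m := by
  rw [← param_ofWeights (sum_bary t)]
  congr 1
  ext i
  simp [ofWeights, baryConst, baryLin]

theorem injective_paramLin : Function.Injective (paramLin σ) := by
  rw [injective_iff_map_eq_zero]
  intro t ht
  have hs : ∑ m, baryLin m t = 0 := by
    have h1 := sum_bary t
    have h2 := sum_bary (0 : EuclideanSpace ℝ (Fin k))
    simp only [map_zero, add_zero] at h2
    rw [Finset.sum_add_distrib, h2] at h1
    linarith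
  have h0 : ∑ m, baryLin m t • σ.points m = 0 := by
    rw [← paramLin_ofWeights hs, ← ht]
    congr 1
  have := σ.independent.eq_zero_of_sum_eq_zero hs h0
  ext i
  simpa [baryLin] using this i.succ (Finset.mem_univ _)

theorem sum_mem_convexHull_iff {w : Fin (k + 1) → ℝ} (hw : ∑ m, w m = 1) :
    ∑ m, w m • σ.points m ∈ convexHull ℝ (Set.range σ.points) ↔ ∀ m, 0 ≤ w m := by
  rw [Affine.Simplex.convexHull_eq_closedInterior,
    ← Finset.affineCombination_eq_linear_combination _ _ _ hw,
    Affine.Simplex.affineCombination_mem_closedInterior_iff hw]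
  refine ⟨fun h m => (h m).1, fun h m => ⟨h m, ?_⟩⟩
  rw [← hw]
  exact Finset.single_le_sum (fun m _ => h m) (Finset.mem_univ m)

theorem exists_weights_of_mem_convexHull {x : EuclideanSpace ℝ (Fin d)}
    (hx : x ∈ convexHull ℝ (Set.range σ.points)) :
    ∃ w : Fin (k + 1) → ℝ, ∑ m, w m = 1 ∧ (∀ m, 0 ≤ w m) ∧ x = ∑ m, w m • σ.points m := by
  obtain ⟨w, hw, rfl⟩ := eq_affineCombination_of_mem_affineSpan_of_fintype
    (convexHull_subset_affineSpan _ hx)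
  rw [Finset.affineCombination_eq_linear_combination _ _ _ hw] at hx ⊢
  exact ⟨w, hw, (sum_mem_convexHull_iff hw).1 hx, rfl⟩

theorem param_mem_convexHull_iff (t : EuclideanSpace ℝ (Fin k)) :
    param σ t ∈ convexHull ℝ (Set.range σ.points) ↔ ∀ m, 0 ≤ baryConst m + baryLin m t := by
  rw [param_eq_sum, sum_mem_convexHull_iff (sum_bary t)]

theorem convexHull_subset_range_param :
    convexHull ℝ (Set.range σ.points) ⊆ Set.range (param σ) := fun x hx => by
  obtain ⟨w, hw, -, rfl⟩ := exists_weights_of_mem_convexHull hx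
  exact ⟨ofWeights w, param_ofWeights hw⟩

theorem continuous_param : Continuous (param σ) :=
  continuous_const.add (paramLin σ).continuous

theorem injective_param : Function.Injective (param σ) :=
  (add_right_injective _).comp injective_paramLin

theorem isCompact_preimage_param :
    IsCompact (param σ ⁻¹' convexHull ℝ (Set.range σ.points)) := by
  obtain ⟨K, -, hK⟩ := (paramLin σ).exists_antilipschitzWith
    (LinearMap.ker_eq_bot.2 injective_paramLin)
  have hc : IsClosedEmbedding (param σ) :=
    (Homeomorph.addLeft _).isClosedEmbedding.comp
      (hK.isClosedEmbedding (paramLin σ).uniformContinuous)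
  exact hc.isCompact_preimage ((Set.finite_range σ.points).isCompact_convexHull (𝕜 := ℝ))

/-- The Hausdorff measure of a simplex is a multiple of Lebesgue measure in affine coordinates. -/
theorem exists_restrict_range_param (σ : Affine.Simplex ℝ (EuclideanSpace ℝ (Fin d)) k) :
    ∃ c : ℝ, 0 < c ∧ (μHE[k]).restrict (Set.range (param σ))
      = ENNReal.ofReal c • Measure.map (param σ) volume := by
  -- The `k`-volume scaling factor of the parametrization, positive because affine independence
  -- makes it injective.
  refine ⟨(paramLin σ).toLinearMap.normDet, ?_, ?_⟩
  · refine lt_of_le_of_ne (LinearMap.normDet_nonneg _) fun h => ?_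
    exact LinearMap.normDet_eq_zero_iff_ker_ne_bot.1 h.symm
      (LinearMap.ker_eq_bot.2 injective_paramLin)
  · ext B hB
    rw [Measure.restrict_apply hB, Measure.smul_apply,
      Measure.map_apply continuous_param.measurable hB, ← Set.image_preimage_eq_inter_range]
    have h1 : param σ '' (param σ ⁻¹' B)
        = (fun x => σ.points 0 + x) '' (paramLin σ '' (param σ ⁻¹' B)) := by
      rw [Set.image_image]; rfl
    have h2 := LinearMap.euclideanHausdorffMeasure_image_eq_normDet_mul_volume
      (paramLin σ).toLinearMap (param σ ⁻¹' B)
    rw [finrank_euclideanSpace, Fintype.card_fin] at h2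
    rw [h1, (isometry_add_left (σ.points 0)).euclideanHausdorffMeasure_image]
    exact h2

end Simplex

/-! ### Laguerre cells in a simplex as polyhedra -/

section SimplexCut

variable {d N k : ℕ} (σ : Affine.Simplex ℝ (EuclideanSpace ℝ (Fin d)) k)
  (y : Fin N → EuclideanSpace ℝ (Fin d)) (i : Fin N)

/-- The linear parts of the inequalities that cut a Laguerre cell out of the affine span of a
simplex: the comparisons with the other points, then the facets of the simplex. -/
noncomputable def cutLin : {j // j ≠ i} ⊕ Fin (k + 1) → EuclideanSpace ℝ (Fin k) →L[ℝ] ℝ :=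
  Sum.elim (fun j => (2 : ℝ) • (innerSL ℝ (y j - y i)).comp (paramLin σ)) (fun m => -baryLin m)

/-- The offsets of the inequalities of `cutLin`, for given differences of the weights. -/
noncomputable def cutOff (a : {j // j ≠ i} → ℝ) : {j // j ≠ i} ⊕ Fin (k + 1) → ℝ :=
  Sum.elim (fun j => a j + (‖y j‖ ^ 2 - ‖y i‖ ^ 2 - 2 * inner ℝ (y j - y i) (σ.points 0)))
    baryConst

theorem cutLin_inl (j : {j // j ≠ i}) (t : EuclideanSpace ℝ (Fin k)) :
    cutLin σ y i (Sum.inl j) t = 2 * inner ℝ (y j - y i) (paramLin σ t) := by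
  simp [cutLin, inner_sub_left]

theorem cutLin_inr (m : Fin (k + 1)) (t : EuclideanSpace ℝ (Fin k)) :
    cutLin σ y i (Sum.inr m) t = -baryLin m t := rfl

/-- The quadratic terms in the moving point cancel, so power comparisons are affine. Ties and strict
comparisons of power distances thus become equalities and strict inequalities for the polyhedron. -/
theorem cutOff_sub_cutLin (ψ : EuclideanSpace ℝ (Fin N)) (j : {j // j ≠ i})
    (t : EuclideanSpace ℝ (Fin k)) :
    cutOff σ y i (fun j => ψ j - ψ i) (Sum.inl j) - cutLin σ y i (Sum.inl j) t
      = ‖param σ t - y j‖ ^ 2 + ψ j - (‖param σ t - y i‖ ^ 2 + ψ i) := by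
  rw [cutLin_inl]
  simp only [cutOff, Sum.elim_inl, norm_sub_sq_real, param, inner_sub_left,
    real_inner_comm (y j), real_inner_comm (y i), inner_add_right]
  ring

theorem cutOff_sub_cutLin_inr (a : {j // j ≠ i} → ℝ) (m : Fin (k + 1))
    (t : EuclideanSpace ℝ (Fin k)) :
    cutOff σ y i a (Sum.inr m) - cutLin σ y i (Sum.inr m) t = baryConst m + baryLin m t := by
  rw [cutLin_inr]
  simp [cutOff]

theorem preimage_param_powerCell (ψ : EuclideanSpace ℝ (Fin N)) :
    param σ ⁻¹' (powerCell y ψ i ∩ convexHull ℝ (Set.range σ.points))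
      = {t | ∀ m, cutLin σ y i m t ≤ cutOff σ y i (fun j => ψ j - ψ i) m} := by
  ext t
  simp only [mem_preimage, mem_inter_iff, param_mem_convexHull_iff, mem_ofPred_eq, Sum.forall,
    powerCell]
  refine and_congr ⟨fun h j => ?_, fun h j => ?_⟩ (forall_congr' fun m => ?_)
  · rw [← sub_nonneg, cutOff_sub_cutLin, sub_nonneg]
    exact h j
  · by_cases hj : j = i
    · rw [hj]
    · have := h ⟨j, hj⟩
      rwa [← sub_nonneg, cutOff_sub_cutLin, sub_nonneg] at this
  · rw [← cutOff_sub_cutLin_inr σ y i (fun j => ψ j - ψ i), sub_nonneg]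

variable {σ y}

/-- No difference `y j - y i` is orthogonal to an edge of the simplex, so its inner product takes
every value along the direction of the edge from `a` to `b`. -/
theorem IsGenericFor.exists_weights_pair (hy : IsGenericFor y σ) {i j : Fin N} (hij : i ≠ j)
    {a b : Fin (k + 1)} (hab : a ≠ b) (r : ℝ) :
    ∃ w : Fin (k + 1) → ℝ, (∀ m, m ≠ a → m ≠ b → w m = 0) ∧ ∑ m, w m = 0 ∧
      inner ℝ (y j - y i) (∑ m, w m • σ.points m) = r := by
  classical
  obtain ⟨w, hw, hs, κ, hκ⟩ := hy.exists_weights (I := {i, j}) (J := {a, b})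
    (by rw [Finset.card_pair hij, Finset.card_pair hab]) (by simp) (fun m => if m = j then r else 0)
  refine ⟨w, fun m h1 h2 => hw m (by simp [h1, h2]), hs, ?_⟩
  have h1 := hκ i (by simp)
  have h2 := hκ j (by simp)
  rw [real_inner_comm, inner_sub_right, h1, h2]
  simp [hij]

theorem cutLin_inl_ne_zero (hy : IsGenericFor y σ) (hk : 2 ≤ k) (j : {j // j ≠ i}) :
    cutLin σ y i (Sum.inl j) ≠ 0 := by
  obtain ⟨w, -, hs, hr⟩ := hy.exists_weights_pair (Ne.symm j.2)
    (a := (⟨0, by omega⟩ : Fin (k + 1))) (b := ⟨1, by omega⟩) (by simp) 1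
  intro h0
  have := cutLin_inl σ y i j (ofWeights w)
  rw [paramLin_ofWeights hs, hr, h0] at this
  norm_num at this

/-- The facet between two cells is parallel to no other facet, which is what the differentiation
under a moving facet requires. Against another point, prescribe three inner products along a
triangle of the simplex; against a facet of the simplex, correct a direction transverse to it along
one of its edges. Both need `2 ≤ k`. -/
theorem exists_cutLin_ne_zero (hy : IsGenericFor y σ) (hk : 2 ≤ k) (j : {j // j ≠ i})
    (m : {j // j ≠ i} ⊕ Fin (k + 1)) (hm : m ≠ Sum.inl j) :
    ∃ t, cutLin σ y i (Sum.inl j) t = 0 ∧ cutLin σ y i m t ≠ 0 := by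
  classical
  rcases m with j' | m
  · have hjj : (j : Fin N) ≠ j' := fun h => hm (by rw [Subtype.ext h])
    have hij := j.2
    have hij' := j'.2
    obtain ⟨a₀, a₁, a₂, h01, h02, h12⟩ : ∃ a₀ a₁ a₂ : Fin (k + 1), a₀ ≠ a₁ ∧ a₀ ≠ a₂ ∧ a₁ ≠ a₂ :=
      ⟨⟨0, by omega⟩, ⟨1, by omega⟩, ⟨2, by omega⟩, by simp, by simp, by simp⟩
    obtain ⟨w, -, hs, κ, hκ⟩ := hy.exists_weights (I := {i, (j : Fin N), (j' : Fin N)})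
      (J := {a₀, a₁, a₂})
      (by rw [Finset.card_eq_three.2 ⟨_, _, _, hij.symm, hij'.symm, hjj, rfl⟩,
            Finset.card_eq_three.2 ⟨_, _, _, h01, h02, h12, rfl⟩])
      (by simp) (fun m => if m = (j' : Fin N) then 1 else 0)
    have h1 := hκ i (by simp)
    have h2 := hκ j (by simp)
    have h3 := hκ j' (by simp)
    refine ⟨ofWeights w, ?_, ?_⟩
    · rw [cutLin_inl, paramLin_ofWeights hs, real_inner_comm, inner_sub_right, h1, h2]
      simp [hjj, hij'.symm]
    · rw [cutLin_inl, paramLin_ofWeights hs, real_inner_comm, inner_sub_right, h1, h3]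
      simp [hij'.symm]
  · obtain ⟨a, b, hab, ha, hb⟩ : ∃ a b : Fin (k + 1), a ≠ b ∧ a ≠ m ∧ b ≠ m := by
      have hcard : 1 < (Finset.univ.erase m).card := by
        rw [Finset.card_erase_of_mem (Finset.mem_univ _), Finset.card_fin]; omega
      obtain ⟨a, ha, b, hb, hab⟩ := Finset.one_lt_card.1 hcard
      exact ⟨a, b, hab, Finset.ne_of_mem_erase ha, Finset.ne_of_mem_erase hb⟩
    set v : Fin (k + 1) → ℝ := Pi.single m 1 - Pi.single a 1 with hv
    have hvs : ∑ q, v q = 0 := by simp [hv]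
    obtain ⟨w, hw, hs, hr⟩ := hy.exists_weights_pair (Ne.symm j.2) hab
      (inner ℝ (y j - y i) (paramLin σ (ofWeights v)))
    refine ⟨ofWeights v - ofWeights w, ?_, ?_⟩
    · rw [map_sub, cutLin_inl, cutLin_inl, paramLin_ofWeights hs, hr, sub_self]
    · rw [cutLin_inr, map_sub, baryLin_ofWeights hvs, baryLin_ofWeights hs,
        hw m ha.symm hb.symm]
      simp [hv, ha.symm]

/-- The mass of a Laguerre cell in a generic simplex is continuously differentiable. -/
theorem exists_hasFDerivAt_cutIntegral (hy : IsGenericFor y σ) (hk : 2 ≤ k)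
    {f : EuclideanSpace ℝ (Fin k) → ℝ} (hf : Continuous f) (hfc : HasCompactSupport f)
    (hf0 : ∀ x, 0 ≤ f x) :
    ∃ g : {j // j ≠ i} → ({j // j ≠ i} → ℝ) → ℝ, (∀ j, Continuous (g j)) ∧ (∀ j a, 0 ≤ g j a) ∧
      (∀ a, HasFDerivAt (fun a => cutIntegral volume f (cutLin σ y i) (cutOff σ y i a))
        (∑ j, g j a • (ContinuousLinearMap.proj j : ({j // j ≠ i} → ℝ) →L[ℝ] ℝ)) a) ∧
      ∀ j a t, cutLin σ y i (Sum.inl j) t = cutOff σ y i a (Sum.inl j) →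
        (∀ m, m ≠ Sum.inl j → cutLin σ y i m t < cutOff σ y i a m) → 0 < f t → 0 < g j a := by
  classical
  choose g hgc hg0 hgd hgp using fun j : {j // j ≠ i} =>
    exists_hasDerivAt_cutIntegral volume hf hfc hf0 (cutLin σ y i) (Sum.inl j)
      (cutLin_inl_ne_zero i hy hk j) (exists_cutLin_ne_zero i hy hk j)
  have hoff : Continuous (cutOff σ y i) := by
    refine continuous_pi fun m => ?_
    rcases m with j | m
    · simp only [cutOff, Sum.elim_inl]; fun_prop
    · simp only [cutOff, Sum.elim_inr]; fun_prop
  have hc : ∀ j, Continuous fun a => g j (cutOff σ y i a) := fun j => (hgc j).comp hoff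
  refine ⟨fun j a => g j (cutOff σ y i a), hc, fun j a => hg0 j _,
    hasFDerivAt_of_continuous_partials hc fun j a => ?_, fun j a t => hgp j _ t⟩
  -- The offset is the weight difference plus this constant, so the two partial derivatives agree.
  set e := ‖y j‖ ^ 2 - ‖y i‖ ^ 2 - 2 * inner ℝ (y j - y i) (σ.points 0) with he
  have hupd : ∀ s, cutOff σ y i (Function.update a j s)
      = Function.update (cutOff σ y i a) (Sum.inl j) (s + e) := fun s => by
    ext m
    rcases m with j' | m
    · by_cases h : j' = j
      · subst h; simp [cutOff, he]
      · simp [cutOff, h]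
    · simp [cutOff]
  simp only [hupd]
  exact HasDerivAt.comp_add_const (a j) e (hgd j (cutOff σ y i a))

end SimplexCut

/-! ### The mass map and its derivative -/

section Mass

variable {d N : ℕ} {ι : Type*} (M : SimplicialMeasure d ι)

theorem measurableEmbedding_param {k : ℕ} (σ : Affine.Simplex ℝ (EuclideanSpace ℝ (Fin d)) k) :
    MeasurableEmbedding (param σ) :=
  continuous_param.measurableEmbedding injective_param

theorem measurableSet_convexHull {k : ℕ} (σ : Affine.Simplex ℝ (EuclideanSpace ℝ (Fin d)) k) :
    MeasurableSet (convexHull ℝ (Set.range σ.points)) :=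
  ((Set.finite_range σ.points).isCompact_convexHull (𝕜 := ℝ)).measurableSet

/-- The density of a regular measure on a simplex, in affine coordinates, extends to a continuous
function with compact support. -/
theorem exists_density_extension (hM : M.IsRegular) (s : ι) :
    ∃ f : EuclideanSpace ℝ (Fin (M.soup.dim s)) → ℝ, Continuous f ∧ HasCompactSupport f ∧
      (∀ t, 0 ≤ f t) ∧
      ∀ t, param (M.soup.simplex s) t ∈ M.soup.cell s →
        f t = M.density s (param (M.soup.simplex s) t) := by
  set σ := M.soup.simplex s
  set P := param σ ⁻¹' M.soup.cell s
  have hPc : IsCompact P := isCompact_preimage_param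
  have hcont : ContinuousOn (fun t => M.density s (param σ t)) P :=
    (hM.continuousOn_density s).comp continuous_param.continuousOn fun t ht => ht
  obtain ⟨g, hg⟩ := ContinuousMap.exists_restrict_eq hPc.isClosed
    ⟨_, continuousOn_iff_continuous_domRestrict.1 hcont⟩
  have hgP : ∀ t ∈ P, g t = M.density s (param σ t) := fun t ht =>
    congrArg (fun h => h ⟨t, ht⟩) hg
  -- The cutoff gives the extension compact support, and the absolute value below keeps it
  -- nonnegative off the simplex; neither alters it on the simplex.
  obtain ⟨χ, hχ1, -, hχc, hχ⟩ := exists_continuous_one_zero_of_isCompact hPc isClosed_empty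
    (disjoint_empty P)
  refine ⟨fun t => χ t * |g t|, by fun_prop, hχc.mul_right, fun t =>
    mul_nonneg (hχ t).1 (abs_nonneg _), fun t ht => ?_⟩
  have h1 : χ t = 1 := hχ1 ht
  simp only
  rw [h1, one_mul, hgP t ht, abs_of_nonneg (M.density_nonneg s _ ht)]

variable [Fintype ι]

theorem exists_toMeasure_eq :
    ∃ c : ι → ℝ, (∀ s, 0 < c s) ∧ ∀ B, MeasurableSet B →
      M.toMeasure B = ∑ s, ENNReal.ofReal (c s) *
        ∫⁻ t in param (M.soup.simplex s) ⁻¹' (B ∩ M.soup.cell s),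
          ENNReal.ofReal (M.density s (param (M.soup.simplex s) t)) := by
  choose c hc0 hc using fun s => exists_restrict_range_param (M.soup.simplex s)
  refine ⟨c, hc0, fun B hB => ?_⟩
  rw [SimplicialMeasure.toMeasure, Measure.finsetSum_apply]
  refine Finset.sum_congr rfl fun s _ => ?_
  have hcell : MeasurableSet (M.soup.cell s) := measurableSet_convexHull _
  rw [withDensity_apply _ hB, Measure.restrict_restrict hB]
  have h1 : (μHE[M.soup.dim s] : Measure (EuclideanSpace ℝ (Fin d))).restrict (B ∩ M.soup.cell s)
      = (μHE[M.soup.dim s].restrict (Set.range (param (M.soup.simplex s)))).restrict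
        (B ∩ M.soup.cell s) := by
    have hsub : B ∩ M.soup.cell s ⊆ Set.range (param (M.soup.simplex s)) :=
      inter_subset_right.trans convexHull_subset_range_param
    rw [Measure.restrict_restrict (hB.inter hcell), inter_eq_left.2 hsub]
  rw [h1, hc, Measure.restrict_smul, lintegral_smul_measure,
    (measurableEmbedding_param _).restrict_map, (measurableEmbedding_param _).lintegral_map]
  rfl

/-- The mass map is a combination of integrals over polyhedra. -/
theorem exists_massMap_eq (hM : M.IsRegular) [IsFiniteMeasure M.toMeasure]
    (y : Fin N → EuclideanSpace ℝ (Fin d)) :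
    ∃ (c : ι → ℝ) (f : ∀ s, EuclideanSpace ℝ (Fin (M.soup.dim s)) → ℝ),
      (∀ s, 0 < c s) ∧ (∀ s, Continuous (f s)) ∧ (∀ s, HasCompactSupport (f s)) ∧
      (∀ s t, 0 ≤ f s t) ∧
      (∀ s t, param (M.soup.simplex s) t ∈ M.soup.cell s → 0 < f s t) ∧
      ∀ ψ i, massMap M y ψ i = ∑ s, c s * cutIntegral volume (f s) (cutLin (M.soup.simplex s) y i)
        (cutOff (M.soup.simplex s) y i fun j => ψ j - ψ i) := by
  obtain ⟨c, hc, hμ⟩ := exists_toMeasure_eq M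
  choose f hf hfc hf0 hfe using exists_density_extension M hM
  refine ⟨c, f, hc, hf, hfc, hf0, fun s t ht => ?_, fun ψ i => ?_⟩
  · obtain ⟨b, hb, hbd⟩ := hM.density_pos s
    rw [hfe s t ht]
    exact hb.trans_le (hbd _ ht)
  have hpow : MeasurableSet (powerCell y ψ i) := by
    have : powerCell y ψ i = ⋂ j, {x | ‖x - y i‖ ^ 2 + ψ i ≤ ‖x - y j‖ ^ 2 + ψ j} := by
      ext; simp [powerCell]
    rw [this]
    exact MeasurableSet.iInter fun j => (isClosed_le (by fun_prop) (by fun_prop)).measurableSet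
  have hsupp : MeasurableSet M.soup.support :=
    MeasurableSet.iUnion fun s => measurableSet_convexHull _
  change (M.toMeasure (laguerreCell M.soup y ψ i)).toReal = _
  have hlag : MeasurableSet (laguerreCell M.soup y ψ i) := hpow.inter hsupp
  rw [hμ _ hlag]
  have hterm : ∀ s, ∫⁻ t in param (M.soup.simplex s) ⁻¹'
        (laguerreCell M.soup y ψ i ∩ M.soup.cell s),
        ENNReal.ofReal (M.density s (param (M.soup.simplex s) t))
      = ENNReal.ofReal (cutIntegral volume (f s) (cutLin (M.soup.simplex s) y i)
        (cutOff (M.soup.simplex s) y i fun j => ψ j - ψ i)) := by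
    intro s
    have hset : laguerreCell M.soup y ψ i ∩ M.soup.cell s
        = powerCell y ψ i ∩ M.soup.cell s := by
      have hsub : M.soup.cell s ⊆ M.soup.support := subset_iUnion M.soup.cell s
      rw [laguerreCell, inter_assoc, inter_eq_right.2 hsub]
    have hmeas : MeasurableSet (param (M.soup.simplex s) ⁻¹'
        (powerCell y ψ i ∩ M.soup.cell s)) :=
      continuous_param.measurable (hpow.inter (measurableSet_convexHull _))
    rw [hset, cutIntegral, ← preimage_param_powerCell,
      ofReal_integral_eq_lintegral_ofReal
        ((hf s).integrable_of_hasCompactSupport (hfc s)).integrableOn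
        (Eventually.of_forall (hf0 s))]
    exact setLIntegral_congr_fun hmeas fun t ht => by simp only [hfe s t ht.2]
  simp only [hterm]
  rw [ENNReal.toReal_sum fun s _ => ENNReal.mul_ne_top ENNReal.ofReal_ne_top ENNReal.ofReal_ne_top]
  refine Finset.sum_congr rfl fun s _ => ?_
  rw [ENNReal.toReal_mul, ENNReal.toReal_ofReal (hc s).le, ENNReal.toReal_ofReal]
  exact integral_nonneg fun t => hf0 s t

/-- The Laplacian `v ↦ (∑ j, w i j (v j - v i))_i` of a weighted directed graph. -/
noncomputable def graphLap (w : Fin N → Fin N → ℝ) :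
    EuclideanSpace ℝ (Fin N) →L[ℝ] EuclideanSpace ℝ (Fin N) :=
  ∑ i, ∑ j, w i j • (EuclideanSpace.proj j - EuclideanSpace.proj i :
    EuclideanSpace ℝ (Fin N) →L[ℝ] ℝ).smulRight (EuclideanSpace.single i (1 : ℝ))

theorem graphLap_apply (w : Fin N → Fin N → ℝ) (v : EuclideanSpace ℝ (Fin N)) (i : Fin N) :
    graphLap w v i = ∑ j, w i j * (v j - v i) := by
  have : ∀ a b, (w a b • (EuclideanSpace.proj b - EuclideanSpace.proj a :
      EuclideanSpace ℝ (Fin N) →L[ℝ] ℝ).smulRight (EuclideanSpace.single a (1 : ℝ))) v i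
      = if i = a then w a b * (v b - v a) else 0 := fun a b => by
    by_cases h : i = a <;> simp [h]
  simp only [graphLap, _root_.sum_apply, WithLp.ofLp_sum, Finset.sum_apply, this]
  rw [Finset.sum_eq_single i]
  · simp
  · intro a _ ha; simp [ha.symm]
  · simp

/-- For points in generic position the mass map is `C¹`, with derivative the Laplacian of a graph
that joins `i` to `j` if these two cells meet in the interior of a simplex. -/
theorem exists_hasFDerivAt_massMap (hM : M.IsRegular) [IsFiniteMeasure M.toMeasure]
    {y : Fin N → EuclideanSpace ℝ (Fin d)} (hy : IsGeneric y M.soup) :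
    ∃ g : Fin N → Fin N → EuclideanSpace ℝ (Fin N) → ℝ,
      (∀ i j, Continuous (g i j)) ∧ (∀ i j ψ, 0 ≤ g i j ψ) ∧
      (∀ ψ, HasFDerivAt (massMap M y) (graphLap fun i j => g i j ψ) ψ) ∧
      ∀ (s : ι) (ψ : EuclideanSpace ℝ (Fin N)) (w : Fin (M.soup.dim s + 1) → ℝ) (i j : Fin N),
        (∀ m, 0 < w m) → ∑ m, w m = 1 → i ≠ j →
        ∀ x, x = ∑ m, w m • (M.soup.simplex s).points m →
        ‖x - y i‖ ^ 2 + ψ i = ‖x - y j‖ ^ 2 + ψ j →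
        (∀ m, m ≠ i → m ≠ j → ‖x - y i‖ ^ 2 + ψ i < ‖x - y m‖ ^ 2 + ψ m) → 0 < g i j ψ := by
  classical
  obtain ⟨c, f, hc, hf, hfc, hf0, hfp, hG⟩ := exists_massMap_eq M hM y
  choose g hgc hg0 hgd hgp using fun s (i : Fin N) =>
    exists_hasFDerivAt_cutIntegral i (hy s) (hM.two_le_dim s) (hf s) (hfc s) (hf0 s)
  let D : ∀ i : Fin N, EuclideanSpace ℝ (Fin N) →L[ℝ] ({j // j ≠ i} → ℝ) := fun i =>
    ContinuousLinearMap.pi fun j => EuclideanSpace.proj (j : Fin N) - EuclideanSpace.proj i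
  have hD : ∀ (i : Fin N) (ψ : EuclideanSpace ℝ (Fin N)),
      D i ψ = fun j : {j // j ≠ i} => ψ j - ψ i := fun i ψ => by ext j; simp [D]
  -- The diagonal weights are set to 0; the Laplacian does not see them, since they multiply `v i -
  -- v i`.
  refine ⟨fun i j ψ => if h : j ≠ i then ∑ s, c s * g s i ⟨j, h⟩ (D i ψ) else 0, ?_, ?_, ?_, ?_⟩
  · intro i j
    by_cases h : j ≠ i
    · simp only [h, ne_eq, not_false_eq_true, dite_true]
      exact continuous_finsetSum _ fun s _ =>
        continuous_const.mul ((hgc s i _).comp (D i).continuous)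
    · simp only [h, dite_false]
      exact continuous_const
  · intro i j ψ
    by_cases h : j ≠ i
    · simp only [h, ne_eq, not_false_eq_true, dite_true]
      exact Finset.sum_nonneg fun s _ => mul_nonneg (hc s).le (hg0 s i _ _)
    · simp only [h, dite_false]
      exact le_rfl
  · intro ψ
    rw [← hasFDerivWithinAt_univ, hasFDerivWithinAt_euclidean]
    intro i
    rw [hasFDerivWithinAt_univ]
    have h1 : (fun ψ => massMap M y ψ i) = fun ψ => ∑ s, c s * cutIntegral volume (f s)
        (cutLin (M.soup.simplex s) y i) (cutOff (M.soup.simplex s) y i (D i ψ)) := by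
      ext ψ
      rw [hG, hD]
    rw [h1]
    have h2 := HasFDerivAt.fun_sum (u := Finset.univ) fun s _ =>
      (((hgd s i (D i ψ)).comp ψ (D i).hasFDerivAt).const_mul (c s))
    refine h2.congr_fderiv ?_
    ext v
    have h3 : ∀ j, (if h : j ≠ i then ∑ s, c s * g s i ⟨j, h⟩ (D i ψ) else 0) * (v j - v i)
        = if h : j ≠ i then (∑ s, c s * g s i ⟨j, h⟩ (D i ψ)) * (v j - v i) else 0 := fun j => by
      split_ifs <;> simp
    have h4 : (EuclideanSpace.proj i : EuclideanSpace ℝ (Fin N) →L[ℝ] ℝ).comp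
        (graphLap fun i j => if h : j ≠ i then ∑ s, c s * g s i ⟨j, h⟩ (D i ψ) else 0) v
        = ∑ j : {j // j ≠ i}, (∑ s, c s * g s i j (D i ψ)) * (v j - v i) := by
      change graphLap _ v i = _
      rw [graphLap_apply]
      simp only [h3]
      rw [← Fintype.sum_subtype_add_sum_subtype (fun j => j ≠ i)]
      have hz : ∀ j : {j // ¬ j ≠ i}, (if h : (j : Fin N) ≠ i then
          (∑ s, c s * g s i ⟨j, h⟩ (D i ψ)) * (v j - v i) else 0) = 0 := fun j => dif_neg j.2
      have hn : ∀ j : {j // j ≠ i}, (if h : (j : Fin N) ≠ i then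
          (∑ s, c s * g s i ⟨j, h⟩ (D i ψ)) * (v j - v i) else 0)
          = (∑ s, c s * g s i j (D i ψ)) * (v j - v i) := fun j => dif_pos j.2
      simp only [hz, hn, Finset.sum_const_zero, add_zero]
    rw [h4]
    simp only [_root_.sum_apply, _root_.smul_apply,
      ContinuousLinearMap.comp_apply, ContinuousLinearMap.proj_apply, hD, smul_eq_mul,
      Finset.mul_sum, Finset.sum_mul]
    rw [Finset.sum_comm]
    simp only [mul_assoc]
  · intro s ψ w i j hw hws hij x hx htie hlt
    simp only [hij.symm, ne_eq, not_false_eq_true, dite_true]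
    refine Finset.sum_pos' (fun s _ => mul_nonneg (hc s).le (hg0 s i _ _))
      ⟨s, Finset.mem_univ _, mul_pos (hc s) (hgp s i _ _ (ofWeights w) ?_ ?_ (hfp s _ ?_))⟩
    · rw [hD, eq_comm, ← sub_eq_zero, cutOff_sub_cutLin, param_ofWeights hws, ← hx, htie, sub_self]
    · intro m hm
      rw [hD, ← sub_pos]
      rcases m with m | m
      · rw [cutOff_sub_cutLin, param_ofWeights hws, ← hx, sub_pos]
        exact hlt m m.2 fun h => hm (by congr 1; exact Subtype.ext h)
      · rw [cutOff_sub_cutLin_inr, bary_ofWeights hws]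
        exact hw m
    · rw [param_ofWeights hws]
      exact (sum_mem_convexHull_iff hws).2 fun m => (hw m).le

end Mass

/-! ### Total mass, bounds on the weights, and connectedness of the cell graph -/

section Mass

variable {d N : ℕ} {ι : Type*} {M : SimplicialMeasure d ι}
  {y : Fin N → EuclideanSpace ℝ (Fin d)}

theorem isCompact_cell (s : ι) : IsCompact (M.soup.cell s) :=
  (Set.finite_range (M.soup.simplex s).points).isCompact_convexHull (𝕜 := ℝ)

theorem iUnion_laguerreCell [NeZero N] (ψ : EuclideanSpace ℝ (Fin N)) :
    ⋃ i, laguerreCell M.soup y ψ i = M.soup.support := by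
  refine subset_antisymm (iUnion_subset fun i => inter_subset_right) fun x hx => ?_
  obtain ⟨i, hi⟩ := Finite.exists_min fun i => ‖x - y i‖ ^ 2 + ψ i
  exact mem_iUnion.2 ⟨i, hi, hx⟩

variable [Fintype ι]

theorem isCompact_support : IsCompact M.soup.support := isCompact_iUnion isCompact_cell

theorem isClosed_laguerreCell (ψ : EuclideanSpace ℝ (Fin N)) (i : Fin N) :
    IsClosed (laguerreCell M.soup y ψ i) := by
  have : powerCell y ψ i = ⋂ j, {x | ‖x - y i‖ ^ 2 + ψ i ≤ ‖x - y j‖ ^ 2 + ψ j} := by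
    ext; simp [powerCell]
  rw [laguerreCell, this]
  exact (isClosed_iInter fun j => isClosed_le (by fun_prop) (by fun_prop)).inter
    isCompact_support.isClosed

theorem massMap_add_ones (ψ : EuclideanSpace ℝ (Fin N)) (c : ℝ) :
    massMap M y (ψ + c • ones N) = massMap M y ψ := by
  have : ∀ i, powerCell y (ψ + c • ones N) i = powerCell y ψ i := fun i => by
    ext x
    simp [powerCell, ones_apply, ← add_assoc]
  simp only [massMap, laguerreCell, this]

/-- In the coordinates of each simplex the intersection lies in a hyperplane, which is proper
because `y j - y i` is not orthogonal to the simplex. -/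
theorem toMeasure_inter_eq_zero (hM : M.IsRegular) (hy : IsGeneric y M.soup)
    (ψ : EuclideanSpace ℝ (Fin N)) {i j : Fin N} (hij : i ≠ j) :
    M.toMeasure (laguerreCell M.soup y ψ i ∩ laguerreCell M.soup y ψ j) = 0 := by
  obtain ⟨c, -, hμ⟩ := exists_toMeasure_eq M
  rw [hμ _ ((isClosed_laguerreCell ψ i).inter (isClosed_laguerreCell ψ j)).measurableSet]
  refine Finset.sum_eq_zero fun s _ => ?_
  have hnull := measure_hyperplane (volume : Measure (EuclideanSpace ℝ (Fin (M.soup.dim s))))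
    (cutLin_inl_ne_zero i (hy s) (hM.two_le_dim s) ⟨j, hij.symm⟩)
    (cutOff (M.soup.simplex s) y i (fun j => ψ j - ψ i) (Sum.inl ⟨j, hij.symm⟩))
  rw [setLIntegral_measure_zero, mul_zero]
  refine measure_mono_null (fun t ht => ?_) hnull
  have h1 := ht.1.1.1 j
  have h2 := ht.1.2.1 i
  simp only [mem_ofPred_eq]
  rw [eq_comm, ← sub_eq_zero, cutOff_sub_cutLin, sub_eq_zero]
  exact le_antisymm h2 h1

theorem toMeasure_finite_eq_zero (hM : M.IsRegular) {F : Set (EuclideanSpace ℝ (Fin d))}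
    (hF : F.Finite) : M.toMeasure F = 0 := by
  obtain ⟨c, -, hμ⟩ := exists_toMeasure_eq M
  rw [hμ _ hF.measurableSet]
  refine Finset.sum_eq_zero fun s _ => ?_
  have : Nonempty (Fin (M.soup.dim s)) := ⟨⟨0, by have := hM.two_le_dim s; omega⟩⟩
  rw [setLIntegral_measure_zero, mul_zero]
  exact ((hF.subset inter_subset_left).preimage injective_param.injOn).measure_zero _

theorem toMeasure_support [IsProbabilityMeasure M.toMeasure] : M.toMeasure M.soup.support = 1 := by
  rw [prob_compl_eq_zero_iff isCompact_support.measurableSet |>.symm]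
  obtain ⟨c, -, hμ⟩ := exists_toMeasure_eq M
  rw [hμ _ isCompact_support.measurableSet.compl]
  refine Finset.sum_eq_zero fun s _ => ?_
  have : M.soup.supportᶜ ∩ M.soup.cell s = ∅ := by
    ext x
    simp only [mem_inter_iff, mem_compl_iff, mem_empty_iff_false, iff_false, not_and]
    exact fun h hx => h (mem_iUnion.2 ⟨s, hx⟩)
  simp [this]

theorem sum_massMap [NeZero N] [IsProbabilityMeasure M.toMeasure] (hM : M.IsRegular)
    (hy : IsGeneric y M.soup) (ψ : EuclideanSpace ℝ (Fin N)) : ∑ i, massMap M y ψ i = 1 := by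
  have h1 := measure_iUnion₀ (μ := M.toMeasure) (f := laguerreCell M.soup y ψ)
    (fun i j hij => toMeasure_inter_eq_zero hM hy ψ hij)
    (fun i => (isClosed_laguerreCell ψ i).measurableSet.nullMeasurableSet)
  rw [iUnion_laguerreCell, toMeasure_support, tsum_fintype] at h1
  have h2 := congrArg ENNReal.toReal h1
  rw [ENNReal.toReal_sum fun i _ => measure_ne_top _ _, ENNReal.toReal_one] at h2
  exact h2.symm

theorem exists_mem_laguerreCell_notMem (hM : M.IsRegular) {ψ : EuclideanSpace ℝ (Fin N)}
    {i : Fin N} (hi : 0 < massMap M y ψ i) {F : Set (EuclideanSpace ℝ (Fin d))} (hF : F.Finite) :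
    ∃ x ∈ laguerreCell M.soup y ψ i, x ∉ F := by
  by_contra! h
  have h0 := measure_mono_null h (toMeasure_finite_eq_zero hM hF)
  change 0 < (M.toMeasure (laguerreCell M.soup y ψ i)).toReal at hi
  rw [h0] at hi
  simp at hi

/-- A cell of positive mass contains a point `x` of `K`, where `ψ i - ψ j ≤ ‖x - y j‖ ^ 2`; this is
bounded because `K` is. -/
theorem exists_weight_bound (hM : M.IsRegular) (y : Fin N → EuclideanSpace ℝ (Fin d)) :
    ∃ R : ℝ, ∀ ψ, (∀ i, 0 < massMap M y ψ i) → ∀ i j, ψ i - ψ j ≤ R := by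
  obtain ⟨r, hr⟩ := isCompact_support (M := M).isBounded.exists_norm_le
  refine ⟨(r + ∑ j, ‖y j‖) ^ 2, fun ψ hψ i j => ?_⟩
  obtain ⟨x, hx, -⟩ := exists_mem_laguerreCell_notMem hM (hψ i) finite_empty
  have h1 := hx.1 j
  have h2 : ‖x - y j‖ ≤ r + ∑ j, ‖y j‖ := (norm_sub_le _ _).trans
    (add_le_add (hr x hx.2) (Finset.single_le_sum (fun j _ => norm_nonneg (y j))
      (Finset.mem_univ j)))
  have h3 : ‖x - y j‖ ^ 2 ≤ (r + ∑ j, ‖y j‖) ^ 2 := by gcongr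
  have h4 : 0 ≤ ‖x - y i‖ ^ 2 := by positivity
  linarith

/-- The points of the face `J` of a simplex where the power distances to the points `I` agree. -/
def tieSet {k : ℕ} (σ : Affine.Simplex ℝ (EuclideanSpace ℝ (Fin d)) k)
    (y : Fin N → EuclideanSpace ℝ (Fin d)) (ψ : EuclideanSpace ℝ (Fin N))
    (I : Finset (Fin N)) (J : Finset (Fin (k + 1))) : Set (EuclideanSpace ℝ (Fin d)) :=
  {x | (∃ w : Fin (k + 1) → ℝ, (∀ m, m ∉ J → w m = 0) ∧ ∑ m, w m = 1 ∧
    x = ∑ m, w m • σ.points m) ∧ ∃ κ, ∀ i ∈ I, ‖x - y i‖ ^ 2 + ψ i = κ}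

/-- Differences of power distances are affine, so the difference of two points of the set has equal
inner products with all `y i`, `i ∈ I`; genericity makes it zero. These sets supply the finite
exceptional set to remove from `K`. -/
theorem subsingleton_tieSet {k : ℕ} {σ : Affine.Simplex ℝ (EuclideanSpace ℝ (Fin d)) k}
    (hy : IsGenericFor y σ) (ψ : EuclideanSpace ℝ (Fin N)) {I : Finset (Fin N)}
    {J : Finset (Fin (k + 1))} (hIJ : I.card = J.card) : (tieSet σ y ψ I J).Subsingleton := by
  rintro x ⟨⟨w, hw, hws, hx⟩, κ, hκ⟩ x' ⟨⟨w', hw', hws', hx'⟩, κ', hκ'⟩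
  have hsub : ∑ m, (w m - w' m) • σ.points m = x - x' := by
    rw [hx, hx', ← Finset.sum_sub_distrib]
    simp only [sub_smul]
  have h0 := hy.eq_zero hIJ (t := fun m => w m - w' m)
    (fun m hm => by rw [hw m hm, hw' m hm, sub_zero])
    (by rw [Finset.sum_sub_distrib, hws, hws', sub_self])
    (κ := (‖x‖ ^ 2 - ‖x'‖ ^ 2 - κ + κ') / 2) (fun i hi => by
      have h1 := hκ i hi
      have h2 := hκ' i hi
      rw [norm_sub_sq_real] at h1 h2
      rw [hsub, inner_sub_left]
      linarith)
  rw [← sub_eq_zero, ← hsub]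
  exact Finset.sum_eq_zero fun m _ => by rw [h0 m, zero_smul]

/-- Two Laguerre cells that meet at a point outside of the tie sets also meet in the interior of
a simplex, away from the other cells. -/
theorem exists_interior_tie {k : ℕ} {σ : Affine.Simplex ℝ (EuclideanSpace ℝ (Fin d)) k}
    (hy : IsGenericFor y σ) {ψ : EuclideanSpace ℝ (Fin N)} {i j : Fin N}
    {x : EuclideanSpace ℝ (Fin d)} (hx : x ∈ convexHull ℝ (Set.range σ.points))
    (hxi : x ∈ powerCell y ψ i) (hxj : x ∈ powerCell y ψ j)
    (hnot : ∀ I J, I.card = J.card → x ∉ tieSet σ y ψ I J) :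
    ∃ w : Fin (k + 1) → ℝ, (∀ m, 0 < w m) ∧ ∑ m, w m = 1 ∧ ∃ z, z = ∑ m, w m • σ.points m ∧
      ‖z - y i‖ ^ 2 + ψ i = ‖z - y j‖ ^ 2 + ψ j ∧
      ∀ m, m ≠ i → m ≠ j → ‖z - y i‖ ^ 2 + ψ i < ‖z - y m‖ ^ 2 + ψ m := by
  classical
  obtain ⟨w, hws, hw0, hxw⟩ := exists_weights_of_mem_convexHull hx
  set J := Finset.univ.filter fun m => w m ≠ 0 with hJ
  set A := Finset.univ.filter fun m => ‖x - y m‖ ^ 2 + ψ m = ‖x - y i‖ ^ 2 + ψ i with hA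
  have hiA : i ∈ A := by simp [hA]
  have hjA : j ∈ A := by simp [hA, le_antisymm (hxj i) (hxi j)]
  -- `J` spans the smallest face containing `x` and `A` is the set of indices minimizing the power
  -- distance. As `x` lies in no tie set, there are more vertices than active indices, leaving
  -- freedom to perturb.
  have hcard : A.card < J.card := by
    by_contra! hle
    obtain ⟨A', hA', hcA'⟩ := Finset.exists_subset_card_eq hle
    refine hnot A' J hcA'
      ⟨⟨w, fun m hm => by simpa [hJ] using hm, hws, hxw⟩, ‖x - y i‖ ^ 2 + ψ i, fun m hm => ?_⟩
    exact (Finset.mem_filter.1 (hA' hm)).2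
  obtain ⟨J', hJ', hcJ'⟩ := Finset.exists_subset_card_eq hcard.le
  set b : ℝ := ((k : ℝ) + 1)⁻¹ with hb
  have hbpos : 0 < b := by positivity
  have hbs : ∑ _m : Fin (k + 1), b = 1 := by
    simp [hb]
    field_simp
  -- Start from the direction towards the barycenter, which enters the interior, and correct it
  -- within the face `J'` so that `i` and `j` stay tied while every other active index becomes
  -- strictly worse.
  obtain ⟨t, ht, hts, κ, hκ⟩ := hy.exists_weights hcJ'.symm ⟨i, hiA⟩
    (fun m => -inner ℝ (∑ q, (b - w q) • σ.points q) (y m) + if m = i ∨ m = j then 0 else -1)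
  set p : Fin (k + 1) → ℝ := fun q => b - w q + t q with hp
  have hps : ∑ q, p q = 0 := by
    simp only [hp, Finset.sum_add_distrib, Finset.sum_sub_distrib, hbs, hws, hts]
    ring
  set u := ∑ q, p q • σ.points q with hu
  have huy : ∀ m ∈ A, inner ℝ u (y m) = κ + if m = i ∨ m = j then 0 else -1 := fun m hm => by
    have h1 : u = ∑ q, (b - w q) • σ.points q + ∑ q, t q • σ.points q := by
      simp only [hu, hp, add_smul, Finset.sum_add_distrib]
    rw [h1, inner_add_left, hκ m hm]
    ring
  have hdiff : ∀ (e : ℝ) m, ‖x + e • u - y m‖ ^ 2 + ψ m - (‖x + e • u - y i‖ ^ 2 + ψ i)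
      = ‖x - y m‖ ^ 2 + ψ m - (‖x - y i‖ ^ 2 + ψ i)
        - 2 * e * (inner ℝ u (y m) - inner ℝ u (y i)) := fun e m => by
    simp only [norm_sub_sq_real, inner_add_left, inner_smul_left]
    simp
    ring
  have haff : ∀ a q : ℝ, 0 < a → ∀ᶠ e in 𝓝[>] (0 : ℝ), 0 < a + e * q := fun a q ha => by
    have hc : Continuous fun e : ℝ => a + e * q := by fun_prop
    exact (hc.tendsto' 0 a (by simp)).eventually_const_lt ha |>.filter_mono nhdsWithin_le_nhds
  -- The correction vanishes off `J`, so weights that are zero at `x` grow like `e * b`; the others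
  -- stay positive for small `e`.
  have hev1 : ∀ᶠ e in 𝓝[>] (0 : ℝ), ∀ m, 0 < w m + e * p m := by
    rw [eventually_all]
    intro m
    by_cases hm : w m = 0
    · have htm : t m = 0 := ht m fun h => by simpa [hJ, hm] using hJ' h
      filter_upwards [self_mem_nhdsWithin] with e he
      have he : 0 < e := he
      simp only [hp, hm, htm]
      ring_nf
      positivity
    · exact haff _ _ (lt_of_le_of_ne (hw0 m) (Ne.symm hm))
  have hev2 : ∀ᶠ e in 𝓝[>] (0 : ℝ), ∀ m, m ∉ A →
      0 < ‖x - y m‖ ^ 2 + ψ m - (‖x - y i‖ ^ 2 + ψ i)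
        + e * -(2 * (inner ℝ u (y m) - inner ℝ u (y i))) := by
    rw [eventually_all]
    intro m
    by_cases hm : m ∈ A
    · exact Eventually.of_forall fun e h => absurd hm h
    · have hlt : ‖x - y i‖ ^ 2 + ψ i < ‖x - y m‖ ^ 2 + ψ m :=
        lt_of_le_of_ne (hxi m) fun h => hm (by simp [hA, h])
      filter_upwards [haff _ (-(2 * (inner ℝ u (y m) - inner ℝ u (y i)))) (sub_pos.2 hlt)]
        with e he _ using he
  obtain ⟨e, ⟨he1, he2⟩, he0⟩ := ((hev1.and hev2).and self_mem_nhdsWithin).exists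
  have he0 : 0 < e := he0
  refine ⟨fun m => w m + e * p m, he1, ?_, x + e • u, ?_, ?_, fun m hmi hmj => ?_⟩
  · rw [Finset.sum_add_distrib, ← Finset.mul_sum, hps, hws]; ring
  · simp only [add_smul, Finset.sum_add_distrib, ← hxw, mul_smul, ← Finset.smul_sum, ← hu]
  · have hj := (Finset.mem_filter.1 hjA).2
    rw [eq_comm, ← sub_eq_zero, hdiff, hj, huy j hjA, huy i hiA]
    simp
  · rw [← sub_pos, hdiff]
    by_cases hm : m ∈ A
    · rw [(Finset.mem_filter.1 hm).2, huy m hm, huy i hiA]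
      simp [hmi, hmj, he0]
    · have := he2 m hm
      linarith

/-- The graph of the Laguerre cells of positive mass that meet in the interior of a simplex is
connected. -/
theorem exists_tie_of_partition (hM : M.IsRegular) (hy : IsGeneric y M.soup) [NeZero N]
    {ψ : EuclideanSpace ℝ (Fin N)} (hψ : ∀ i, 0 < massMap M y ψ i) (P : Fin N → Prop)
    (h1 : ∃ i, P i) (h2 : ∃ j, ¬ P j) :
    ∃ i j, P i ∧ ¬ P j ∧ ∃ (s : ι) (w : Fin (M.soup.dim s + 1) → ℝ), (∀ m, 0 < w m) ∧
      ∑ m, w m = 1 ∧ ∃ z, z = ∑ m, w m • (M.soup.simplex s).points m ∧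
      ‖z - y i‖ ^ 2 + ψ i = ‖z - y j‖ ^ 2 + ψ j ∧
      ∀ m, m ≠ i → m ≠ j → ‖z - y i‖ ^ 2 + ψ i < ‖z - y m‖ ^ 2 + ψ m := by
  set F : Set (EuclideanSpace ℝ (Fin d)) := M.soup.support ∩ ⋃ s, ⋃ I : Finset (Fin N),
    ⋃ J : Finset (Fin (M.soup.dim s + 1)), ⋃ _ : I.card = J.card,
      tieSet (M.soup.simplex s) y ψ I J
  have hFfin : F.Finite := (finite_iUnion fun s => finite_iUnion fun I => finite_iUnion fun J =>
    finite_iUnion fun h => (subsingleton_tieSet (hy s) ψ h).finite).subset inter_subset_right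
  have hconn := hM.isConnected_diff F inter_subset_left hFfin
  have hclosed : ∀ Q : Fin N → Prop, IsClosed (⋃ i, ⋃ _ : Q i, laguerreCell M.soup y ψ i) :=
    fun Q => isClosed_iUnion_of_finite fun i => isClosed_iUnion_of_finite fun _ =>
      isClosed_laguerreCell ψ i
  have hne : ∀ Q : Fin N → Prop, (∃ i, Q i) →
      ((M.soup.support \ F) ∩ ⋃ i, ⋃ _ : Q i, laguerreCell M.soup y ψ i).Nonempty := by
    rintro Q ⟨i, hi⟩
    obtain ⟨x, hx, hxF⟩ := exists_mem_laguerreCell_notMem hM (hψ i) hFfin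
    exact ⟨x, ⟨hx.2, hxF⟩, mem_iUnion₂.2 ⟨i, hi, hx⟩⟩
  have hcover : M.soup.support \ F ⊆ (⋃ i, ⋃ _ : P i, laguerreCell M.soup y ψ i) ∪
      ⋃ i, ⋃ _ : ¬ P i, laguerreCell M.soup y ψ i := by
    intro x hx
    have hx' := hx.1
    rw [← iUnion_laguerreCell (y := y) ψ] at hx'
    obtain ⟨i, hi⟩ := mem_iUnion.1 hx'
    by_cases hPi : P i
    · exact Or.inl (mem_iUnion₂.2 ⟨i, hPi, hi⟩)
    · exact Or.inr (mem_iUnion₂.2 ⟨i, hPi, hi⟩)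
  -- The two groups of cells are closed, cover `K \ F` and both meet it, the latter because a finite
  -- set has mass zero; connectedness yields a common point outside `F`.
  obtain ⟨x, ⟨hxs, hxF⟩, hx1, hx2⟩ := isPreconnected_closed_iff.1 hconn.isPreconnected _ _
    (hclosed P) (hclosed fun i => ¬ P i) hcover (hne P h1) (hne _ h2)
  obtain ⟨i, hi, hxi⟩ := mem_iUnion₂.1 hx1
  obtain ⟨j, hj, hxj⟩ := mem_iUnion₂.1 hx2
  obtain ⟨s, hs⟩ := mem_iUnion.1 hxs
  refine ⟨i, j, hi, hj, s, exists_interior_tie (hy s) hs hxi.1 hxj.1 fun I J hIJ hx => hxF ⟨hxs, ?_⟩⟩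
  simp only [mem_iUnion]
  exact ⟨s, I, J, hIJ, hx⟩

/-- The kernel of the Laplacian of a strongly connected graph consists of the constants. -/
theorem eq_of_graphLap_eq_zero {w : Fin N → Fin N → ℝ} (hw : ∀ i j, 0 ≤ w i j)
    (hconn : ∀ P : Fin N → Prop, (∃ i, P i) → (∃ j, ¬ P j) → ∃ i j, P i ∧ ¬ P j ∧ 0 < w i j)
    {v : EuclideanSpace ℝ (Fin N)} (hv : graphLap w v = 0) (i j : Fin N) : v i = v j := by
  have : Nonempty (Fin N) := ⟨i⟩
  -- Maximum principle: an edge from the set where `v` is maximal to its complement would make the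
  -- Laplacian negative at its source.
  obtain ⟨m, hm⟩ := Finite.exists_max fun i => v i
  have hall : ∀ i, v i = v m := by
    by_contra! hne
    obtain ⟨a, b, ha, hb, hab⟩ := hconn (fun i => v i = v m) ⟨m, rfl⟩ hne
    have h0 : ∑ q, w a q * (v q - v a) = 0 := by
      rw [← graphLap_apply, hv]; rfl
    have hle : ∀ q, w a q * (v q - v a) ≤ 0 := fun q =>
      mul_nonpos_of_nonneg_of_nonpos (hw a q) (by rw [ha]; linarith [hm q])
    have hlt : w a b * (v b - v a) < 0 :=
      mul_neg_of_pos_of_neg hab (by rw [ha]; exact sub_neg.2 (lt_of_le_of_ne (hm b) hb))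
    have := Finset.sum_lt_sum (fun q (_ : q ∈ Finset.univ) => hle q) ⟨b, Finset.mem_univ b, hlt⟩
    rw [h0, Finset.sum_const_zero] at this
    exact lt_irrefl _ this
  rw [hall i, hall j]

theorem exists_isMassLike [NeZero N] [IsProbabilityMeasure M.toMeasure] (hM : M.IsRegular)
    (hy : IsGeneric y M.soup) : ∃ A, IsMassLike (massMap M y) A := by
  obtain ⟨g, hgc, hg0, hgd, hgp⟩ := exists_hasFDerivAt_massMap M hM hy
  refine ⟨fun ψ => graphLap fun i j => g i j ψ, hgd, ?_, massMap_add_ones, sum_massMap hM hy,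
    fun ψ hψ v hv => eq_of_graphLap_eq_zero (fun i j => hg0 i j ψ) (fun P h1 h2 => ?_) hv,
    exists_weight_bound hM y⟩
  · exact continuous_finsetSum _ fun i _ => continuous_finsetSum _ fun j _ =>
      (hgc i j).smul continuous_const
  · obtain ⟨i, j, hi, hj, s, w, hw, hws, z, hz, htie, hlt⟩ :=
      exists_tie_of_partition hM hy hψ P h1 h2
    exact ⟨i, j, hi, hj, hgp s ψ w i j hw hws (fun h => hj (h ▸ hi)) z hz htie hlt⟩

end Mass

end SemiDiscrete

/-! ### The main theorem -/

open SemiDiscrete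
theorem mainTheorem1 {d N : ℕ} {ι : Type*} [Fintype ι]
    (M : SimplicialMeasure d ι) [IsProbabilityMeasure M.toMeasure] (hM : M.IsRegular)
    (y : Fin N → EuclideanSpace ℝ (Fin d)) (hy : IsGeneric y M.soup)
    (ν : EuclideanSpace ℝ (Fin N)) (hν_nonneg : ∀ i, 0 ≤ ν i) (hν_sum : ∑ i, ν i = 1)
    (ε₀ : ℝ) (hε₀ : 0 < ε₀) :
    ∃ τ : ℝ, 0 < τ ∧ τ ≤ 1 ∧
      ∀ ψ₀ : EuclideanSpace ℝ (Fin N),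
        ε₀ = 1 / 2 * min (⨅ i, massMap M y ψ₀ i) (⨅ i, ν i) →
        ∀ η : ℝ, 0 < η →
          ∃ T : ℕ,
            (∃ ψ : ℕ → EuclideanSpace ℝ (Fin N),
              IsDampedNewtonRun (massMap M y) ν ε₀ η ψ₀ T ψ ∧
              ‖massMap M y (ψ T) - ν‖ < η) ∧
            ∀ (n : ℕ) (ψ : ℕ → EuclideanSpace ℝ (Fin N)),
              IsDampedNewtonRun (massMap M y) ν ε₀ η ψ₀ n ψ →
              n ≤ T ∧ ∀ k < n,
                ‖massMap M y (ψ (k + 1)) - ν‖ ≤ (1 - τ / 2) * ‖massMap M y (ψ k) - ν‖ := by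
  have hN : NeZero N := ⟨fun h => by subst h; simp at hν_sum⟩
  obtain ⟨A, hA⟩ := exists_isMassLike hM hy
  -- `τ` is chosen before `ψ₀`. If some `ν i < 2 * ε₀`, no `ψ₀` is compatible with `ε₀`, and any `τ`
  -- will do.
  by_cases hν₂ : ∀ i, 2 * ε₀ ≤ ν i
  · obtain ⟨τ, hτ, hτ1, hconv⟩ := hA.dampedNewton_converges hν_sum hε₀ hν₂
    refine ⟨τ, hτ, hτ1, fun ψ₀ hψ₀ => hconv ψ₀ fun i => ?_⟩
    have h1 : ⨅ i, massMap M y ψ₀ i ≤ massMap M y ψ₀ i :=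
      ciInf_le (Set.finite_range _).bddBelow i
    have h2 := min_le_left (⨅ i, massMap M y ψ₀ i) (⨅ i, ν i)
    linarith
  · push Not at hν₂
    obtain ⟨i, hi⟩ := hν₂
    refine ⟨1, one_pos, le_rfl, fun ψ₀ hψ₀ => absurd hi (not_lt.2 ?_)⟩
    have h1 : ⨅ i, ν i ≤ ν i := ciInf_le (Set.finite_range _).bddBelow i
    have h2 := min_le_right (⨅ i, massMap M y ψ₀ i) (⨅ i, ν i)
    linarith
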